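/- Let $d,m$ be natural numbers. There is an integer $k$, depending only on $d$ and $m$, such that the following holds for every $\varepsilon>0$, every $T>0$ and every $U^0:\mathbb{R}^d\to\mathbb{R}^{m\times m}$ that is of class $C^k$, $2\pi$-periodic in each coordinate, and satisfies $\|U^0(x)\|_F\le\sqrt m$ for all $x$, where $\|\cdot\|_F$ is the Frobenius norm. Put $\Omega=[-\pi,\pi]^d$. There is a constant $C>0$, depending on $\varepsilon,U^0,T$ (and $d,m$), with the following property. Let $U:[0,\infty)\times\mathbb{R}^d\to\mathbb{R}^{m\times m}$ be the classical solution, $2\pi$-periodic in each coordinate of $x$ (continuous on $[0,\infty)\times\mathbb{R}^d$ and of class $C^{1,2}$ for $t>0$), of $$\partial_t U=\varepsilon^2\Delta U+U-UU^\top U\quad(t>0),\qquad U(0,\cdot)=U^0 .$$ For $\tau>0$ let $U^n$ be the Strang splitting solution $$U^{n+1}=\mathcal S_{\mathcal L}(\tau/2)\,\mathcal S_{\mathcal N}(\tau)\,\mathcal S_{\mathcal L}(\tau/2)\,U^n,\qquad n\ge 0,$$ starting from $U^0$, where $\mathcal S_{\mathcal L}(t)=e^{t\varepsilon^2\Delta}$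 is the heat semigroup applied entrywise, and $\mathcal S_{\mathcal N}(t)$ is the pointwise map $$\mathcal S_{\mathcal N}(t)A=\bigl((e^{2t}-1)AA^\top+I\bigr)^{-1/2}e^tA .$$ Then for every $\tau>0$ $$\sup_{n\ge1,\;n\tau\le T}\|U^n-U(n\tau,\cdot)\|_{L^2(\Omega)}\le C\tau^2,$$ where $\|V\|_{L^2(\Omega)}^2=\int_\Omega\|V(x)\|_F^2\,dx$. -/

import Mathlib

open MeasureTheory Set
open scoped ENNReal MatrixOrder

noncomputable section

namespace MAC

/-- Frobenius norm of a real matrix. -/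
def frobNorm {m : ℕ} (A : Matrix (Fin m) (Fin m) ℝ) : ℝ :=
  Real.sqrt (∑ i, ∑ j, A i j ^ 2)

/-- The fundamental cell `[-π, π]^d` of the torus. Functions on the torus are represented by
`2π`-periodic functions on `ℝ^d`. -/
def cell (d : ℕ) : Set (EuclideanSpace ℝ (Fin d)) :=
  {x | ∀ i, x i ∈ Icc (-Real.pi) Real.pi}

/-- `2π`-periodicity in each coordinate. -/
def TorusPeriodic {d m : ℕ} (V : EuclideanSpace ℝ (Fin d) → Matrix (Fin m) (Fin m) ℝ) : Prop :=
  ∀ (l : Fin d) (x : EuclideanSpace ℝ (Fin d)),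
    V (x + EuclideanSpace.single l (2 * Real.pi)) = V x

/-- `L²([-π, π]^d)` norm of a matrix field, with the Frobenius norm on matrices. It takes values
in `[0, ∞]`, so that no convention about non-integrable functions enters. -/
def normL2 {d m : ℕ} (V : EuclideanSpace ℝ (Fin d) → Matrix (Fin m) (Fin m) ℝ) : ℝ≥0∞ :=
  eLpNorm (fun x => frobNorm (V x)) 2 (volume.restrict (cell d))

/-- The heat kernel `(4πs)^{-d/2} exp(-|y|²/(4s))`, for `s > 0`. -/
def heatKernel (d : ℕ) (s : ℝ) (y : EuclideanSpace ℝ (Fin d)) : ℝ :=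
  (4 * Real.pi * s) ^ (-(d : ℝ) / 2) * Real.exp (-‖y‖ ^ 2 / (4 * s))

/-- The heat semigroup `e^{sΔ}`, for `s > 0`, acting on (periodic) functions on `ℝ^d` by
convolution with the heat kernel. On the torus, `e^{sΔ}` multiplies the Fourier mode
`e^{i k·x}` by `e^{-s|k|²}`. -/
def heatSemigroup {d : ℕ} (s : ℝ) (f : EuclideanSpace ℝ (Fin d) → ℝ)
    (x : EuclideanSpace ℝ (Fin d)) : ℝ :=
  ∫ y, heatKernel d s y * f (x - y)

/-- Linear propagator `S_L(t) = e^{t ε² Δ}`, acting entrywise. -/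
def linProp {d m : ℕ} (ε t : ℝ) (V : EuclideanSpace ℝ (Fin d) → Matrix (Fin m) (Fin m) ℝ) :
    EuclideanSpace ℝ (Fin d) → Matrix (Fin m) (Fin m) ℝ :=
  fun x => Matrix.of fun i j => heatSemigroup (t * ε ^ 2) (fun y => V y i j) x

/-- Nonlinear propagator `S_N(t) A = ((e^{2t} - 1) A Aᵀ + I)^{-1/2} e^t A`; here `CFC.sqrt` is the
positive semidefinite square root. -/
def nonlinProp {m : ℕ} (t : ℝ) (A : Matrix (Fin m) (Fin m) ℝ) : Matrix (Fin m) (Fin m) ℝ :=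
  (CFC.sqrt ((Real.exp (2 * t) - 1) • (A * A.transpose) + 1))⁻¹ * (Real.exp t • A)

/-- One Strang step `S_L(τ/2) S_N(τ) S_L(τ/2)`. -/
def strangStep {d m : ℕ} (ε τ : ℝ) (V : EuclideanSpace ℝ (Fin d) → Matrix (Fin m) (Fin m) ℝ) :
    EuclideanSpace ℝ (Fin d) → Matrix (Fin m) (Fin m) ℝ :=
  linProp ε (τ / 2) (fun x => nonlinProp τ (linProp ε (τ / 2) V x))

/-- The numerical solution `Uⁿ`. -/
def strang {d m : ℕ} (ε τ : ℝ) (U₀ : EuclideanSpace ℝ (Fin d) → Matrix (Fin m) (Fin m) ℝ)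
    (n : ℕ) : EuclideanSpace ℝ (Fin d) → Matrix (Fin m) (Fin m) ℝ :=
  (strangStep ε τ)^[n] U₀

/-- `U` is a classical (`C^{1,2}` for positive times, continuous up to time `0`) solution on
`[0, ∞) × torus` of `∂ₜ U = ε² Δ U + U - U Uᵀ U` with initial value `U₀`.
Continuity of `∂ₜ U` for `t > 0` follows from the equation. -/
structure IsSolution {d m : ℕ} (ε : ℝ)
    (U₀ : EuclideanSpace ℝ (Fin d) → Matrix (Fin m) (Fin m) ℝ)
    (U : ℝ → EuclideanSpace ℝ (Fin d) → Matrix (Fin m) (Fin m) ℝ) : Prop where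
  init : ∀ x, U 0 x = U₀ x
  periodic : ∀ t, 0 ≤ t → TorusPeriodic (U t)
  continuousOn : ∀ i j, ContinuousOn
    (fun p : ℝ × EuclideanSpace ℝ (Fin d) => U p.1 p.2 i j) (Ici 0 ×ˢ univ)
  contDiff : ∀ t, 0 < t → ∀ i j, ContDiff ℝ 2 (fun x => U t x i j)
  continuousOn_iteratedFDeriv : ∀ k : ℕ, k ≤ 2 → ∀ i j, ContinuousOn
    (fun p : ℝ × EuclideanSpace ℝ (Fin d) => iteratedFDeriv ℝ k (fun y => U p.1 y i j) p.2)
    (Ioi 0 ×ˢ univ)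
  equation : ∀ t, 0 < t → ∀ x i j, HasDerivAt (fun s => U s x i j)
    (ε ^ 2 * Laplacian.laplacian (fun y => U t y i j) x
      + (U t x - U t x * (U t x).transpose * U t x) i j) t

end MAC

end

noncomputable section

namespace MAC

universe u

open Filter Topology

/-! The error is estimated in the supremum norm; since the cell has finite measure, the $L^2$ bound
follows. Matrices are treated as vectors of `MSp m`, whose Euclidean norm is the Frobenius norm.

Stability is taken from the exact equation, not from the scheme. The cubic term is monotone
(`trace_cubic_monotone`), so the reaction is one-sided Lipschitz with constant 1. A maximum
principle for vector-valued functions (`norm_sub_le_of_residual`) then shows that the exact solution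
and an approximate one with residual at most $r$ and initial distance $\delta$ are at most
$e^t(\delta+rt)$ apart.

Consistency is measured against `taylorSol`, the quadratic polynomial in time that the equation
prescribes for initial value $U^n$. Its residual is $O(t^2)$ (`exists_residual_taylorSol_le`), and
one Strang step agrees with it up to $O(t^3)$ (`splitStep_sub_taylorSol`). All expansions start from
the numerical solution, so the exact solution is never differentiated beyond what the equation
requires.

The price is a bound on $U^n$ in $C^6$, uniform in $n$ and $\tau$ (`exists_bddC_splitStep_iterate`).
Heat averaging does not increase sup norms of derivatives, and the nonlinear flow is the identity
plus $O(t)$ in $C^k$, so the natural scale of the derivatives grows by a factor $1+Ct$ per step. Six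
derivatives are needed because a remainder of order $t^3$ costs three Laplacians.

The errors satisfy $e_{n+1}\le e^\tau(e_n+C_1\tau^3)+C_2\tau^3$, and $n\tau\le T$ turns this into
$O(\tau^2)$. -/

/-- The ambient space `ℝ^d`. -/
abbrev Sp (d : ℕ) := EuclideanSpace ℝ (Fin d)

/-! ### The Gaussian at time one: mass, first moment, gradient. -/

section HeatKernel

variable {d : ℕ}

lemma heatKernel_one (y : Sp d) :
    heatKernel d 1 y = (4 * Real.pi) ^ (-(d : ℝ) / 2) * Real.exp (-(1 / 4) * ‖y‖ ^ 2) := by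
  unfold heatKernel
  congr 2
  · ring
  · ring

lemma heatKernel_one_nonneg (y : Sp d) : 0 ≤ heatKernel d 1 y := by
  rw [heatKernel_one]; positivity

lemma continuous_heatKernel_one : Continuous (heatKernel d 1) := by
  have : heatKernel d 1 = fun y : Sp d =>
      (4 * Real.pi) ^ (-(d : ℝ) / 2) * Real.exp (-(1 / 4) * ‖y‖ ^ 2) := by
    funext y; exact heatKernel_one y
  rw [this]; fun_prop

lemma integrable_exp_neg_mul_norm_sq {b : ℝ} (hb : 0 < b) :
    Integrable (fun y : Sp d => Real.exp (-b * ‖y‖ ^ 2)) := by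
  apply Integrable.of_integral_ne_zero
  rw [GaussianFourier.integral_rexp_neg_mul_sq_norm hb]
  have := Real.pi_pos
  positivity

lemma integrable_heatKernel_one : Integrable (heatKernel d 1) := by
  have : heatKernel d 1 = fun y : Sp d =>
      (4 * Real.pi) ^ (-(d : ℝ) / 2) * Real.exp (-(1 / 4) * ‖y‖ ^ 2) := by
    funext y; exact heatKernel_one y
  rw [this]
  exact (integrable_exp_neg_mul_norm_sq (by norm_num)).const_mul _

lemma integral_heatKernel_one : ∫ y : Sp d, heatKernel d 1 y = 1 := by
  simp_rw [heatKernel_one]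
  rw [integral_const_mul, GaussianFourier.integral_rexp_neg_mul_sq_norm (by norm_num)]
  have hp : (0 : ℝ) < 4 * Real.pi := by have := Real.pi_pos; positivity
  rw [show Real.pi / (1 / 4) = 4 * Real.pi by ring, finrank_euclideanSpace, Fintype.card_fin,
    ← Real.rpow_add hp]
  rw [show -(d : ℝ) / 2 + d / 2 = 0 by ring, Real.rpow_zero]

lemma integrable_norm_mul_heatKernel_one :
    Integrable (fun y : Sp d => ‖y‖ * heatKernel d 1 y) := by
  have h : Integrable (fun y : Sp d =>
      4 * (4 * Real.pi) ^ (-(d : ℝ) / 2) * Real.exp (-(1 / 8) * ‖y‖ ^ 2)) :=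
    (integrable_exp_neg_mul_norm_sq (by norm_num)).const_mul _
  refine h.mono' (continuous_norm.mul continuous_heatKernel_one).aestronglyMeasurable
    (Eventually.of_forall fun y => ?_)
  rw [Real.norm_of_nonneg (mul_nonneg (norm_nonneg _) (heatKernel_one_nonneg y)), heatKernel_one]
  -- Half of the Gaussian decay absorbs the factor $|y|$ and the other half remains integrable.
  have h1 : ‖y‖ ≤ 4 * Real.exp (1 / 8 * ‖y‖ ^ 2) := by
    have := Real.add_one_le_exp (1 / 8 * ‖y‖ ^ 2)
    nlinarith [sq_nonneg (‖y‖ - 1)]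
  have h2 : Real.exp (-(1 / 8) * ‖y‖ ^ 2)
      = Real.exp (1 / 8 * ‖y‖ ^ 2) * Real.exp (-(1 / 4) * ‖y‖ ^ 2) := by
    rw [← Real.exp_add]; congr 1; ring
  rw [h2]
  have h3 : 0 ≤ (4 * Real.pi) ^ (-(d : ℝ) / 2) * Real.exp (-(1 / 4) * ‖y‖ ^ 2) := by positivity
  nlinarith [mul_le_mul_of_nonneg_right h1 h3]

lemma hasFDerivAt_heatKernel_one (y : Sp d) :
    HasFDerivAt (heatKernel d 1) ((-(1 / 2) * heatKernel d 1 y) • innerSL ℝ y) y := by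
  have h : HasFDerivAt (fun y : Sp d =>
      (4 * Real.pi) ^ (-(d : ℝ) / 2) * Real.exp (-(1 / 4) * ‖y‖ ^ 2))
      ((4 * Real.pi) ^ (-(d : ℝ) / 2) •
        (Real.exp (-(1 / 4) * ‖y‖ ^ 2) • ((-(1 / 4) : ℝ) • (2 • innerSL ℝ y)))) y :=
    (((hasStrictFDerivAt_norm_sq y).hasFDerivAt.const_mul (-(1 / 4))).exp).const_mul _
  have e : heatKernel d 1 = fun y : Sp d =>
      (4 * Real.pi) ^ (-(d : ℝ) / 2) * Real.exp (-(1 / 4) * ‖y‖ ^ 2) := by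
    funext y; exact heatKernel_one y
  rw [e]
  refine h.congr_fderiv ?_
  rw [smul_smul, smul_smul, ← Nat.cast_smul_eq_nsmul ℝ 2, smul_smul]
  congr 1
  push_cast
  ring

end HeatKernel

/-! ### The heat semigroup on bounded functions and the heat equation. -/

section HeatOp

variable {d : ℕ} {F : Type*} [NormedAddCommGroup F] [NormedSpace ℝ F]

/-- The heat semigroup acting on vector-valued functions, written as an average against the
heat kernel at time one. It makes sense at time zero. -/
def heatOp (s : ℝ) (g : Sp d → F) (x : Sp d) : F :=
  ∫ y, heatKernel d 1 y • g (x - Real.sqrt s • y)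

/-- The substitution $y=\sqrt s\,z$; the Jacobian $s^{d/2}$ cancels the normalisation of the kernel.
-/
lemma heatSemigroup_eq_heatOp {s : ℝ} (hs : 0 < s) (f : Sp d → ℝ) (x : Sp d) :
    heatSemigroup s f x = heatOp s f x := by
  unfold heatSemigroup heatOp
  have h := Measure.integral_comp_smul (volume : Measure (Sp d))
    (fun y => heatKernel d s y * f (x - y)) (Real.sqrt s)
  have hsq : 0 < Real.sqrt s := Real.sqrt_pos.2 hs
  have hk : ∀ y : Sp d, heatKernel d 1 y
      = Real.sqrt s ^ d * heatKernel d s (Real.sqrt s • y) := by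
    intro y
    have hp := Real.pi_pos
    rw [heatKernel_one]
    unfold heatKernel
    rw [norm_smul, mul_pow, Real.norm_of_nonneg hsq.le, Real.sq_sqrt hs.le,
      Real.mul_rpow (by positivity) hs.le]
    have h1 : Real.sqrt s ^ d * s ^ (-(d : ℝ) / 2) = 1 := by
      rw [Real.sqrt_eq_rpow, ← Real.rpow_natCast, ← Real.rpow_mul hs.le, ← Real.rpow_add hs]
      rw [show 1 / 2 * (d : ℝ) + -(d : ℝ) / 2 = 0 by ring, Real.rpow_zero]
    have h2 : -(s * ‖y‖ ^ 2) / (4 * s) = -(1 / 4) * ‖y‖ ^ 2 := by field_simp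
    rw [h2]
    linear_combination (-(4 * Real.pi) ^ (-(d : ℝ) / 2) * Real.exp (-(1 / 4) * ‖y‖ ^ 2)) * h1
  simp_rw [hk, smul_eq_mul, mul_assoc]
  rw [integral_const_mul, h, finrank_euclideanSpace, Fintype.card_fin, smul_eq_mul, ← mul_assoc,
    abs_of_pos (by positivity), mul_inv_cancel₀ (by positivity), one_mul]

lemma integrable_heatOp {g : Sp d → F} (hg : Continuous g) {B : ℝ} (hB : ∀ x, ‖g x‖ ≤ B)
    (s : ℝ) (x : Sp d) : Integrable (fun y => heatKernel d 1 y • g (x - Real.sqrt s • y)) := by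
  refine (integrable_heatKernel_one.mul_const B).mono'
    (continuous_heatKernel_one.smul (by fun_prop)).aestronglyMeasurable
    (Eventually.of_forall fun y => ?_)
  rw [norm_smul, Real.norm_of_nonneg (heatKernel_one_nonneg y)]
  exact mul_le_mul_of_nonneg_left (hB _) (heatKernel_one_nonneg y)

/-- The kernel is a probability density. No measurability of `g` is needed, because a Bochner
integral that does not exist is zero; this allows the bound to be used on remainder terms. -/
lemma norm_heatOp_le {g : Sp d → F} {B : ℝ} (hB : ∀ x, ‖g x‖ ≤ B) (s : ℝ) (x : Sp d) :
    ‖heatOp s g x‖ ≤ B := by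
  unfold heatOp
  refine (norm_integral_le_of_norm_le (integrable_heatKernel_one.mul_const B)
    (Eventually.of_forall fun y => ?_)).trans ?_
  · rw [norm_smul, Real.norm_of_nonneg (heatKernel_one_nonneg y)]
    exact mul_le_mul_of_nonneg_left (hB _) (heatKernel_one_nonneg y)
  · rw [integral_mul_const, integral_heatKernel_one, one_mul]

lemma heatOp_add {g h : Sp d → F} (hg : Continuous g) (hh : Continuous h) {B B' : ℝ}
    (hB : ∀ x, ‖g x‖ ≤ B) (hB' : ∀ x, ‖h x‖ ≤ B') (s : ℝ) (x : Sp d) :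
    heatOp s (fun y => g y + h y) x = heatOp s g x + heatOp s h x := by
  unfold heatOp
  simp_rw [smul_add]
  exact integral_add (integrable_heatOp hg hB s x) (integrable_heatOp hh hB' s x)

lemma heatOp_smul (c : ℝ) (g : Sp d → F) (s : ℝ) (x : Sp d) :
    heatOp s (fun y => c • g y) x = c • heatOp s g x := by
  unfold heatOp
  rw [← integral_smul]
  congr 1; funext y
  rw [smul_comm]

lemma heatOp_zero [CompleteSpace F] (g : Sp d → F) (x : Sp d) : heatOp 0 g x = g x := by
  unfold heatOp
  simp [integral_smul_const, integral_heatKernel_one]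

lemma continuous_heatOp {g : Sp d → F} (hg : Continuous g) {B : ℝ} (hB : ∀ x, ‖g x‖ ≤ B) :
    Continuous (fun p : ℝ × Sp d => heatOp p.1 g p.2) := by
  refine continuous_of_dominated (bound := fun y => heatKernel d 1 y * B)
    (fun p => (integrable_heatOp hg hB p.1 p.2).aestronglyMeasurable)
    (fun p => Eventually.of_forall fun y => ?_) (integrable_heatKernel_one.mul_const B)
    (Eventually.of_forall fun y => by fun_prop)
  rw [norm_smul, Real.norm_of_nonneg (heatKernel_one_nonneg y)]
  exact mul_le_mul_of_nonneg_left (hB _) (heatKernel_one_nonneg y)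

lemma hasFDerivAt_heatOp {g : Sp d → F} (hg : ContDiff ℝ 1 g) {B B' : ℝ}
    (hB : ∀ x, ‖g x‖ ≤ B) (hB' : ∀ x, ‖fderiv ℝ g x‖ ≤ B') (s : ℝ) (x : Sp d) :
    HasFDerivAt (heatOp s g) (heatOp s (fderiv ℝ g) x) x := by
  refine hasFDerivAt_integral_of_dominated_of_fderiv_le (s := univ)
    (F' := fun x y => heatKernel d 1 y • fderiv ℝ g (x - Real.sqrt s • y))
    (bound := fun y => heatKernel d 1 y * B') univ_mem
    (Eventually.of_forall fun x => (integrable_heatOp hg.continuous hB s x).aestronglyMeasurable)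
    (integrable_heatOp hg.continuous hB s x)
    (integrable_heatOp (hg.continuous_fderiv one_ne_zero) hB' s x).aestronglyMeasurable
    (Eventually.of_forall fun y x _ => ?_) (integrable_heatKernel_one.mul_const B')
    (Eventually.of_forall fun y x _ => ?_)
  · rw [norm_smul, Real.norm_of_nonneg (heatKernel_one_nonneg y)]
    exact mul_le_mul_of_nonneg_left (hB' _) (heatKernel_one_nonneg y)
  · have h := (hg.differentiable one_ne_zero (x - Real.sqrt s • y)).hasFDerivAt
    have h2 : HasFDerivAt (fun x : Sp d => x - Real.sqrt s • y) (ContinuousLinearMap.id ℝ _) x :=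
      (hasFDerivAt_id x).sub_const _
    have h3 : HasFDerivAt (fun x => heatKernel d 1 y • g (x - Real.sqrt s • y)) _ x :=
      (h.comp x h2).const_smul (heatKernel d 1 y)
    simpa using h3

/-- Averaging commutes with differentiation. Each bound `B i` is kept without any extra factor,
which is essential because the operator is applied about $2T/\tau$ times. The target space is
quantified inside the induction since the derivative takes values in a different space. -/
lemma contDiff_heatOp (s : ℝ) (n : ℕ) : ∀ {G : Type u} [NormedAddCommGroup G] [NormedSpace ℝ G]
    {g : Sp d → G} (_ : ContDiff ℝ n g) {B : ℕ → ℝ}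
    (_ : ∀ i ≤ n, ∀ x, ‖iteratedFDeriv ℝ i g x‖ ≤ B i),
    ContDiff ℝ n (heatOp s g) ∧ ∀ i ≤ n, ∀ x, ‖iteratedFDeriv ℝ i (heatOp s g) x‖ ≤ B i := by
  induction n with
  | zero =>
    intro G _ _ g hg B hB
    have h0 : ∀ x, ‖g x‖ ≤ B 0 := fun x => by simpa using hB 0 le_rfl x
    refine ⟨?_, ?_⟩
    · rw [Nat.cast_zero, contDiff_zero]
      exact (continuous_heatOp (contDiff_zero (𝕜 := ℝ).1 (by simpa using hg)) h0).comp
        (Continuous.prodMk_right s)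
    · intro i hi x
      obtain rfl : i = 0 := by omega
      rw [norm_iteratedFDeriv_zero]
      exact norm_heatOp_le h0 s x
  | succ n ih =>
    intro G _ _ g hg B hB
    have h0 : ∀ x, ‖g x‖ ≤ B 0 := fun x => by simpa using hB 0 (by omega) x
    have h1 : ∀ x, ‖fderiv ℝ g x‖ ≤ B 1 := fun x => by
      have := hB 1 (by omega) x
      rwa [← zero_add 1, ← norm_iteratedFDeriv_fderiv, norm_iteratedFDeriv_zero] at this
    have hg1 : ContDiff ℝ 1 g := hg.of_le (by exact_mod_cast Nat.succ_le_succ (Nat.zero_le n))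
    have hd := hasFDerivAt_heatOp hg1 h0 h1 s
    have hfd : fderiv ℝ (heatOp s g) = heatOp s (fderiv ℝ g) := by
      funext x; exact (hd x).fderiv
    have hg' : ContDiff ℝ n (fderiv ℝ g) := by
      rw [Nat.cast_succ, contDiff_succ_iff_fderiv] at hg; exact hg.2.2
    obtain ⟨hc, hb⟩ := ih hg' (B := fun i => B (i + 1)) (fun i hi x => by
      rw [norm_iteratedFDeriv_fderiv]; exact hB (i + 1) (by omega) x)
    refine ⟨?_, ?_⟩
    · rw [Nat.cast_succ, contDiff_succ_iff_fderiv]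
      exact ⟨fun x => (hd x).differentiableAt, by simp, hfd ▸ hc⟩
    · intro i hi x
      rcases i with _ | i
      · rw [norm_iteratedFDeriv_zero]; exact norm_heatOp_le h0 s x
      · rw [← norm_iteratedFDeriv_fderiv, hfd]; exact hb i (by omega) x

/-- The Laplacian, written with second Fréchet derivatives. -/
def lap (g : Sp d → F) (x : Sp d) : F :=
  ∑ i : Fin d, fderiv ℝ (fderiv ℝ g) x (EuclideanSpace.single i 1) (EuclideanSpace.single i 1)

lemma integrable_heatKernel_coord {g : Sp d → F} (hg : Continuous g) {B : ℝ}
    (hB : ∀ x, ‖g x‖ ≤ B) (i : Fin d) (s : ℝ) (x : Sp d) :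
    Integrable (fun y : Sp d => heatKernel d 1 y • y i • g (x - Real.sqrt s • y)) := by
  have hB0 : 0 ≤ B := (norm_nonneg _).trans (hB 0)
  have hkc := continuous_heatKernel_one (d := d)
  refine (integrable_norm_mul_heatKernel_one.mul_const B).mono'
    (Continuous.aestronglyMeasurable (by fun_prop)) (Eventually.of_forall fun y => ?_)
  have hy : ‖y i‖ ≤ ‖y‖ := PiLp.norm_apply_le y i
  have hk := heatKernel_one_nonneg y
  rw [norm_smul, norm_smul, Real.norm_of_nonneg hk, ← mul_assoc, mul_comm ‖y‖]
  gcongr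
  exact hB _

/-- Gaussian integration by parts: $y_i$ times the kernel is $-2\,\partial_i$ of the kernel, and the
chain rule for $x-\sqrt s\,y$ supplies the factor $\sqrt s$. -/
lemma integral_heatKernel_coord {g : Sp d → F} (hg : ContDiff ℝ 1 g) {B B' : ℝ}
    (hB : ∀ x, ‖g x‖ ≤ B) (hB' : ∀ x, ‖fderiv ℝ g x‖ ≤ B') (i : Fin d) (s : ℝ) (x : Sp d) :
    ∫ y, heatKernel d 1 y • y i • g (x - Real.sqrt s • y)
      = -(2 * Real.sqrt s) • heatOp s (fun z => fderiv ℝ g z (EuclideanSpace.single i 1)) x := by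
  set e : Sp d := EuclideanSpace.single i 1
  have he : ‖e‖ = 1 := by simp [e]
  have hin : ∀ y : Sp d, inner ℝ y e = y i := fun y => by
    simp [e, EuclideanSpace.inner_single_right]
  have hcd : Continuous (fun z => fderiv ℝ g z e) :=
    (hg.continuous_fderiv one_ne_zero).clm_apply continuous_const
  have hbd : ∀ z, ‖fderiv ℝ g z e‖ ≤ B' := fun z => by
    have := (fderiv ℝ g z).le_opNorm e
    rw [he, mul_one] at this
    exact this.trans (hB' z)
  have hint : Integrable (fun y : Sp d =>
      (-(1 / 2) * heatKernel d 1 y * y i) • g (x - Real.sqrt s • y)) := by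
    refine ((integrable_heatKernel_coord hg.continuous hB i s x).smul (-(1 / 2) : ℝ)).congr
      (Eventually.of_forall fun y => ?_)
    simp only [Pi.smul_apply, smul_smul, mul_assoc]
  have key := integral_bilinear_hasLineDerivAt_right_eq_neg_left_of_integrable
    (μ := (volume : Measure (Sp d))) (v := e) (B := ContinuousLinearMap.lsmul ℝ ℝ)
    (f := heatKernel d 1) (f' := fun y => -(1 / 2) * heatKernel d 1 y * y i)
    (g := fun y => g (x - Real.sqrt s • y))
    (g' := fun y => -Real.sqrt s • fderiv ℝ g (x - Real.sqrt s • y) e)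
    (by simpa using hint)
    (by
      have := ((integrable_heatOp hcd hbd s x).smul (-Real.sqrt s))
      refine this.congr (Eventually.of_forall fun y => ?_)
      simp [smul_smul, mul_comm])
    (by simpa using integrable_heatOp hg.continuous hB s x)
    (fun y _ => by
      have := (hasFDerivAt_heatKernel_one y).hasLineDerivAt e
      simpa [hin] using this)
    (fun y _ => by
      have h := (hg.differentiable one_ne_zero (x - Real.sqrt s • y)).hasFDerivAt
      have h2 : HasFDerivAt (fun y : Sp d => x - Real.sqrt s • y)
          (-(Real.sqrt s • ContinuousLinearMap.id ℝ (Sp d))) y :=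
        ((hasFDerivAt_id y).const_smul (Real.sqrt s)).const_sub x
      have : HasLineDerivAt ℝ (fun y => g (x - Real.sqrt s • y)) _ y e :=
        (h.comp y h2).hasLineDerivAt e
      simpa using this)
  simp only [ContinuousLinearMap.lsmul_apply] at key
  have e1 : ∫ y, heatKernel d 1 y • -Real.sqrt s • fderiv ℝ g (x - Real.sqrt s • y) e
      = -Real.sqrt s • heatOp s (fun z => fderiv ℝ g z e) x := by
    unfold heatOp
    rw [← integral_smul]
    congr 1; funext y; rw [smul_comm]
  have e2 : ∫ y : Sp d, (-(1 / 2) * heatKernel d 1 y * y i) • g (x - Real.sqrt s • y)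
      = -(1 / 2 : ℝ) • ∫ y, heatKernel d 1 y • y i • g (x - Real.sqrt s • y) := by
    rw [← integral_smul]
    congr 1; funext y; rw [smul_smul, smul_smul, mul_assoc]
  rw [e1, e2] at key
  calc ∫ y, heatKernel d 1 y • y i • g (x - Real.sqrt s • y)
      = (2 : ℝ) • -(-(1 / 2 : ℝ) • ∫ y, heatKernel d 1 y • y i • g (x - Real.sqrt s • y)) := by
        rw [← neg_smul, smul_smul]; norm_num
    _ = _ := by rw [← key, smul_smul]; congr 1; ring

lemma fderiv_fderiv_apply {g : Sp d → F} (hg : ContDiff ℝ 2 g) (v : Sp d) (z : Sp d) :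
    HasFDerivAt (fun z => fderiv ℝ g z v) ((fderiv ℝ (fderiv ℝ g) z).flip v) z := by
  have h1 : ContDiff ℝ 1 (fderiv ℝ g) := by
    have : ContDiff ℝ (1 + 1) g := by simpa [one_add_one_eq_two] using hg
    exact (contDiff_succ_iff_fderiv.1 this).2.2
  have h := (h1.differentiable one_ne_zero z).hasFDerivAt.clm_apply (hasFDerivAt_const v z)
  refine h.congr_fderiv ?_
  ext w; simp

/-- Differentiating under the integral produces $-\frac1{2\sqrt s}Dg(x-\sqrt s\,y)\,y$. Integration
by parts in each coordinate gains exactly the factor $\sqrt s$ that is lost and turns the first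
moment into the Laplacian. -/
lemma hasDerivAt_heatOp {g : Sp d → F} (hg : ContDiff ℝ 2 g) {B : ℝ}
    (hB : ∀ i ≤ 2, ∀ x, ‖iteratedFDeriv ℝ i g x‖ ≤ B) {s : ℝ} (hs : 0 < s) (x : Sp d) :
    HasDerivAt (fun r => heatOp r g x) (heatOp s (lap g) x) s := by
  have h0 : ∀ x, ‖g x‖ ≤ B := fun x => by simpa using hB 0 (by omega) x
  have h1 : ∀ x, ‖fderiv ℝ g x‖ ≤ B := fun x => by
    have := hB 1 (by omega) x
    rwa [← zero_add 1, ← norm_iteratedFDeriv_fderiv, norm_iteratedFDeriv_zero] at this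
  have h2 : ∀ x, ‖fderiv ℝ (fderiv ℝ g) x‖ ≤ B := fun x => by
    have := hB 2 (by omega) x
    rwa [← one_add_one_eq_two, ← norm_iteratedFDeriv_fderiv, ← zero_add 1,
      ← norm_iteratedFDeriv_fderiv, norm_iteratedFDeriv_zero] at this
  have hB0 : 0 ≤ B := (norm_nonneg _).trans (h0 0)
  have hg1 : ContDiff ℝ 1 g := hg.of_le one_le_two
  have hfc : Continuous (fderiv ℝ g) := hg1.continuous_fderiv one_ne_zero
  have hgc := hg.continuous
  have hkc := continuous_heatKernel_one (d := d)
  have hg' : ContDiff ℝ 1 (fderiv ℝ g) := by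
    have : ContDiff ℝ (1 + 1) g := by simpa [one_add_one_eq_two] using hg
    exact (contDiff_succ_iff_fderiv.1 this).2.2
  have key := (hasDerivAt_integral_of_dominated_loc_of_deriv_le
    (μ := (volume : Measure (Sp d))) (s := Ioi (s / 2)) (x₀ := s)
    (F := fun r y => heatKernel d 1 y • g (x - Real.sqrt r • y))
    (F' := fun r y =>
      heatKernel d 1 y • (-(1 / (2 * Real.sqrt r))) • fderiv ℝ g (x - Real.sqrt r • y) y)
    -- On $r>s/2$ the singular factor $1/\sqrt r$ is bounded, and the first moment of the kernel is
    -- integrable.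
    (bound := fun y => (‖y‖ * heatKernel d 1 y) * (1 / (2 * Real.sqrt (s / 2)) * B))
    (Ioi_mem_nhds (by linarith))
    (Eventually.of_forall fun r => Continuous.aestronglyMeasurable (by fun_prop))
    (integrable_heatOp hgc h0 s x)
    (Continuous.aestronglyMeasurable (by fun_prop))
    (Eventually.of_forall fun y r hr => ?_)
    (integrable_norm_mul_heatKernel_one.mul_const _)
    (Eventually.of_forall fun y r hr => ?_)).2
  · refine key.congr_deriv ?_
    have hsum : ∀ y : Sp d,
        heatKernel d 1 y • (-(1 / (2 * Real.sqrt s))) • fderiv ℝ g (x - Real.sqrt s • y) y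
        = ∑ i : Fin d, (-(1 / (2 * Real.sqrt s))) • heatKernel d 1 y • y i •
          fderiv ℝ g (x - Real.sqrt s • y) (EuclideanSpace.single i 1) := by
      intro y
      have hy : y = ∑ i : Fin d, y i • EuclideanSpace.single i (1 : ℝ) := by
        have := (EuclideanSpace.basisFun (Fin d) ℝ).sum_repr y
        simpa using this.symm
      conv_lhs => rw [hy, map_sum]
      rw [← hy, Finset.smul_sum, Finset.smul_sum]
      refine Finset.sum_congr rfl fun i _ => ?_
      rw [map_smul, smul_comm (heatKernel d 1 y)]
    have hcd : ∀ i : Fin d, ContDiff ℝ 1 (fun z => fderiv ℝ g z (EuclideanSpace.single i 1)) :=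
      fun i => hg'.clm_apply contDiff_const
    have hle : ∀ (i : Fin d) {G : Type _} [NormedAddCommGroup G] [NormedSpace ℝ G]
        (L : Sp d →L[ℝ] G), ‖L (EuclideanSpace.single i 1)‖ ≤ ‖L‖ := fun i G _ _ L => by
      have := L.le_opNorm (EuclideanSpace.single i 1)
      simpa using this
    have hb0 : ∀ (i : Fin d) z, ‖fderiv ℝ g z (EuclideanSpace.single i 1)‖ ≤ B :=
      fun i z => (hle i _).trans (h1 z)
    have hfd : ∀ i : Fin d, fderiv ℝ (fun z => fderiv ℝ g z (EuclideanSpace.single i 1))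
        = fun z => (fderiv ℝ (fderiv ℝ g) z).flip (EuclideanSpace.single i 1) :=
      fun i => funext fun z => (fderiv_fderiv_apply hg _ z).fderiv
    have hb1 : ∀ (i : Fin d) z,
        ‖fderiv ℝ (fun z => fderiv ℝ g z (EuclideanSpace.single i 1)) z‖ ≤ B := fun i z => by
      rw [hfd]
      refine (hle i _).trans ?_
      rw [ContinuousLinearMap.opNorm_flip]; exact h2 z
    simp_rw [hsum]
    rw [integral_finsetSum]
    · have : ∀ i : Fin d, ∫ y : Sp d, (-(1 / (2 * Real.sqrt s))) • heatKernel d 1 y • y i •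
          fderiv ℝ g (x - Real.sqrt s • y) (EuclideanSpace.single i 1)
          = ∫ y, heatKernel d 1 y • fderiv ℝ (fderiv ℝ g) (x - Real.sqrt s • y)
            (EuclideanSpace.single i 1) (EuclideanSpace.single i 1) := by
        intro i
        rw [integral_smul, integral_heatKernel_coord (hcd i) (hb0 i) (hb1 i), smul_smul, hfd]
        have hsq : Real.sqrt s ≠ 0 := (Real.sqrt_pos.2 hs).ne'
        rw [show -(1 / (2 * Real.sqrt s)) * -(2 * Real.sqrt s) = 1 by field_simp, one_smul]
        rfl
      simp_rw [this]
      unfold heatOp lap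
      simp_rw [Finset.smul_sum]
      rw [integral_finsetSum]
      intro i _
      exact integrable_heatOp (B := B)
        (((hg'.continuous_fderiv one_ne_zero).clm_apply continuous_const).clm_apply
          continuous_const)
        (fun z => (hle i _).trans ((hle i _).trans (h2 z))) s x
    · intro i _
      exact (integrable_heatKernel_coord (hcd i).continuous (hb0 i) i s x).smul _
  · have hk := heatKernel_one_nonneg y
    have hr' : s / 2 < r := hr
    have hsq : 0 < Real.sqrt (s / 2) := Real.sqrt_pos.2 (by linarith)
    have hsr : Real.sqrt (s / 2) ≤ Real.sqrt r := Real.sqrt_le_sqrt hr'.le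
    rw [norm_smul, norm_smul, Real.norm_of_nonneg hk, norm_neg,
      Real.norm_of_nonneg (by positivity)]
    have e1 : ‖fderiv ℝ g (x - Real.sqrt r • y) y‖ ≤ B * ‖y‖ :=
      ((fderiv ℝ g _).le_opNorm y).trans (by gcongr; exact h1 _)
    calc heatKernel d 1 y * (1 / (2 * Real.sqrt r) * ‖fderiv ℝ g (x - Real.sqrt r • y) y‖)
        ≤ heatKernel d 1 y * (1 / (2 * Real.sqrt (s / 2)) * (B * ‖y‖)) := by gcongr
      _ = _ := by ring
  · have hr' : 0 < r := lt_trans (by linarith) (show s / 2 < r from hr)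
    have e1 : HasDerivAt (fun r => x - Real.sqrt r • y) (-((1 / (2 * Real.sqrt r)) • y)) r :=
      ((Real.hasDerivAt_sqrt hr'.ne').smul_const y).const_sub x
    have e2 := (hg1.differentiable one_ne_zero (x - Real.sqrt r • y)).hasFDerivAt
    have e3 : HasDerivAt (fun r => heatKernel d 1 y • g (x - Real.sqrt r • y)) _ r :=
      (e2.comp_hasDerivAt r e1).const_smul (heatKernel d 1 y)
    refine e3.congr_deriv ?_
    rw [map_neg, map_smul, neg_smul]

end HeatOp

/-! ### Families of functions bounded in $C^k$. -/

section UniformBounds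

variable {d : ℕ} {ι : Type*} {F G : Type*} [NormedAddCommGroup F] [NormedSpace ℝ F]
  [NormedAddCommGroup G] [NormedSpace ℝ G]

/-- `g` is of class `C^k` and its derivatives up to order `k` are bounded by `B`. -/
def BddC (k : ℕ) (B : ℝ) (g : Sp d → F) : Prop :=
  ContDiff ℝ k g ∧ ∀ i ≤ k, ∀ x, ‖iteratedFDeriv ℝ i g x‖ ≤ B

/-- A family of functions that is bounded in `C^k`. -/
def UnifC (k : ℕ) (v : ι → Sp d → F) : Prop := ∃ B, ∀ p, BddC k B (v p)

lemma BddC.mono {k l : ℕ} {B B' : ℝ} {g : Sp d → F} (h : BddC k B g) (hl : l ≤ k) (hB : B ≤ B') :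
    BddC l B' g :=
  ⟨h.1.of_le (by exact_mod_cast hl), fun i hi x => (h.2 i (hi.trans hl) x).trans hB⟩

lemma BddC.norm_le {k : ℕ} {B : ℝ} {g : Sp d → F} (h : BddC k B g) (x : Sp d) : ‖g x‖ ≤ B := by
  simpa using h.2 0 (Nat.zero_le _) x

lemma UnifC.mono {k l : ℕ} {v : ι → Sp d → F} (h : UnifC k v) (hl : l ≤ k) : UnifC l v := by
  obtain ⟨B, hB⟩ := h
  exact ⟨B, fun p => (hB p).mono hl le_rfl⟩

lemma UnifC.contDiff {k : ℕ} {v : ι → Sp d → F} (h : UnifC k v) (p : ι) : ContDiff ℝ k (v p) := by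
  obtain ⟨B, hB⟩ := h
  exact (hB p).1

lemma UnifC.continuous {k : ℕ} {v : ι → Sp d → F} (h : UnifC k v) (p : ι) : Continuous (v p) :=
  (h.contDiff p).continuous

lemma UnifC.bound {k : ℕ} {v : ι → Sp d → F} (h : UnifC k v) :
    ∃ B, 0 ≤ B ∧ ∀ p x, ‖v p x‖ ≤ B := by
  obtain ⟨B, hB⟩ := h
  exact ⟨max B 0, le_max_right _ _, fun p x => ((hB p).norm_le x).trans (le_max_left _ _)⟩

lemma UnifC.clm_comp {k : ℕ} {v : ι → Sp d → F} (h : UnifC k v) (L : F →L[ℝ] G) :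
    UnifC k (fun p x => L (v p x)) := by
  obtain ⟨B, hB⟩ := h
  refine ⟨‖L‖ * B, fun p => ⟨L.contDiff.comp (hB p).1, fun i hi x => ?_⟩⟩
  exact (L.norm_iteratedFDeriv_comp_left (hB p).1.contDiffAt (by exact_mod_cast hi)).trans
    (mul_le_mul_of_nonneg_left ((hB p).2 i hi x) (norm_nonneg _))

lemma UnifC.add {k : ℕ} {v w : ι → Sp d → F} (hv : UnifC k v) (hw : UnifC k w) :
    UnifC k (fun p x => v p x + w p x) := by
  obtain ⟨B, hB⟩ := hv
  obtain ⟨B', hB'⟩ := hw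
  refine ⟨B + B', fun p => ⟨(hB p).1.add (hB' p).1, fun i hi x => ?_⟩⟩
  have hi' : (i : WithTop ℕ∞) ≤ k := by exact_mod_cast hi
  have : iteratedFDeriv ℝ i (fun x => v p x + w p x) x
      = iteratedFDeriv ℝ i (v p) x + iteratedFDeriv ℝ i (w p) x :=
    iteratedFDeriv_add_apply ((hB p).1.contDiffAt.of_le hi') ((hB' p).1.contDiffAt.of_le hi')
  rw [this]
  exact (norm_add_le _ _).trans (add_le_add ((hB p).2 i hi x) ((hB' p).2 i hi x))

lemma UnifC.const_smul {k : ℕ} {v : ι → Sp d → F} (hv : UnifC k v) (c : ℝ) :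
    UnifC k (fun p x => c • v p x) := by
  simpa using hv.clm_comp (c • ContinuousLinearMap.id ℝ F)

lemma UnifC.prodMk {k : ℕ} {v : ι → Sp d → F} {w : ι → Sp d → G} (hv : UnifC k v)
    (hw : UnifC k w) : UnifC k (fun p x => (v p x, w p x)) := by
  simpa using (hv.clm_comp (ContinuousLinearMap.inl ℝ F G)).add
    (hw.clm_comp (ContinuousLinearMap.inr ℝ F G))

lemma exists_bound_iteratedFDeriv [FiniteDimensional ℝ F] {Q : F → G} {k : ℕ}
    (hQ : ContDiff ℝ k Q) (R : ℝ) :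
    ∃ C, 0 ≤ C ∧ ∀ i ≤ k, ∀ a, ‖a‖ ≤ R → ‖iteratedFDeriv ℝ i Q a‖ ≤ C := by
  have : ProperSpace F := FiniteDimensional.proper ℝ F
  have h : ∀ i : Fin (k + 1), ∃ C, ∀ a ∈ Metric.closedBall (0 : F) R,
      ‖iteratedFDeriv ℝ i Q a‖ ≤ C := fun i =>
    (isCompact_closedBall 0 R).exists_bound_of_continuousOn
      (hQ.continuous_iteratedFDeriv (by exact_mod_cast Nat.lt_succ_iff.1 i.2)).continuousOn
  choose C hC using h
  refine ⟨∑ i, |C i|, Finset.sum_nonneg fun i _ => abs_nonneg _, fun i hi a ha => ?_⟩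
  refine ((hC ⟨i, Nat.lt_succ_of_le hi⟩ a (by simpa using ha)).trans (le_abs_self _)).trans ?_
  exact Finset.single_le_sum (f := fun i => |C i|) (fun i _ => abs_nonneg _) (Finset.mem_univ _)

lemma UnifC.comp_contDiff [FiniteDimensional ℝ F] {k : ℕ} {v : ι → Sp d → F} (hv : UnifC k v)
    {Q : F → G} (hQ : ContDiff ℝ k Q) : UnifC k (fun p x => Q (v p x)) := by
  obtain ⟨B, hB⟩ := hv
  obtain ⟨C, hC0, hC⟩ := exists_bound_iteratedFDeriv hQ B
  -- The bound for derivatives of a composition wants the inner derivatives below $D^j$; with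
  -- $D\ge1$ and $D\ge B$ this holds for every $j\ge1$.
  set D := max 1 B
  have hD : 1 ≤ D := le_max_left _ _
  refine ⟨k.factorial * C * D ^ k, fun p => ⟨hQ.comp (hB p).1, fun i hi x => ?_⟩⟩
  have h := norm_iteratedFDeriv_comp_le (n := i) hQ (hB p).1 (by exact_mod_cast hi) x
    (C := C) (D := D) (fun j hj => hC j (hj.trans hi) _ ((hB p).norm_le x))
    (fun j hj hj' => ((hB p).2 j (hj'.trans hi) x).trans
      ((le_max_right 1 B).trans (le_self_pow₀ hD (by omega))))
  refine h.trans ?_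
  gcongr

lemma contDiff_fderiv_of_succ {k : ℕ} {g : Sp d → F} (hg : ContDiff ℝ (k + 1 : ℕ) g) :
    ContDiff ℝ k (fderiv ℝ g) := by
  rw [Nat.cast_succ, contDiff_succ_iff_fderiv] at hg
  exact hg.2.2

lemma UnifC.fderiv {k : ℕ} {v : ι → Sp d → F} (hv : UnifC (k + 1) v) :
    UnifC k (fun p x => fderiv ℝ (v p) x) := by
  obtain ⟨B, hB⟩ := hv
  refine ⟨B, fun p => ⟨contDiff_fderiv_of_succ (hB p).1, fun i hi x => ?_⟩⟩
  exact (norm_iteratedFDeriv_fderiv.le).trans ((hB p).2 (i + 1) (by omega) x)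

/-- The trace of a bilinear map, as a continuous linear map. -/
def bilinTrace (d : ℕ) (F : Type*) [NormedAddCommGroup F] [NormedSpace ℝ F] :
    (Sp d →L[ℝ] Sp d →L[ℝ] F) →L[ℝ] F :=
  ∑ i : Fin d, (ContinuousLinearMap.apply ℝ F (EuclideanSpace.single i (1 : ℝ) : Sp d)).comp
    (ContinuousLinearMap.apply ℝ (Sp d →L[ℝ] F) (EuclideanSpace.single i (1 : ℝ) : Sp d))

lemma lap_eq_bilinTrace (g : Sp d → F) (x : Sp d) :
    lap g x = bilinTrace d F (_root_.fderiv ℝ (_root_.fderiv ℝ g) x) := by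
  simp [lap, bilinTrace]

lemma UnifC.lap {k : ℕ} {v : ι → Sp d → F} (hv : UnifC (k + 2) v) :
    UnifC k (fun p => lap (v p)) := by
  have h := (UnifC.fderiv (UnifC.fderiv hv)).clm_comp (bilinTrace d F)
  have e : (fun p => MAC.lap (v p)) = fun p x =>
      bilinTrace d F (_root_.fderiv ℝ (_root_.fderiv ℝ (v p)) x) := by
    funext p x; exact lap_eq_bilinTrace _ _
  rw [e]; exact h

lemma lap_add {g h : Sp d → F} (hg : ContDiff ℝ 2 g) (hh : ContDiff ℝ 2 h) (x : Sp d) :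
    lap (fun y => g y + h y) x = lap g x + lap h x := by
  have hg1 : Differentiable ℝ g := hg.differentiable two_ne_zero
  have hh1 : Differentiable ℝ h := hh.differentiable two_ne_zero
  have hg2 : Differentiable ℝ (fderiv ℝ g) :=
    (contDiff_fderiv_of_succ (k := 1) hg).differentiable one_ne_zero
  have hh2 : Differentiable ℝ (fderiv ℝ h) :=
    (contDiff_fderiv_of_succ (k := 1) hh).differentiable one_ne_zero
  have e : fderiv ℝ (fun y => g y + h y) = fun y => fderiv ℝ g y + fderiv ℝ h y := by
    funext y; exact fderiv_fun_add (hg1 y) (hh1 y)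
  rw [lap_eq_bilinTrace, lap_eq_bilinTrace, lap_eq_bilinTrace, e, fderiv_fun_add (hg2 x) (hh2 x),
    map_add]

lemma lap_const_smul (c : ℝ) {g : Sp d → F} (hg : ContDiff ℝ 2 g) (x : Sp d) :
    lap (fun y => c • g y) x = c • lap g x := by
  have hg1 : Differentiable ℝ g := hg.differentiable two_ne_zero
  have hg2 : Differentiable ℝ (fderiv ℝ g) :=
    (contDiff_fderiv_of_succ (k := 1) hg).differentiable one_ne_zero
  have e : fderiv ℝ (fun y => c • g y) = fun y => c • fderiv ℝ g y := by
    funext y; exact fderiv_fun_const_smul (hg1 y) c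
  rw [lap_eq_bilinTrace, lap_eq_bilinTrace, e, fderiv_fun_const_smul (hg2 x), map_smul]

end UniformBounds

/-! ### Taylor estimates on $[0,H]$ with derivatives only at positive times. -/

section Taylor

variable {F : Type*} [NormedAddCommGroup F] [NormedSpace ℝ F]

/-- The mean value inequality on $[\delta,h]$, followed by $\delta\to0$. Only continuity is asked at
the left endpoint because the heat semigroup is parametrised through $\sqrt s$ and the equation is
available only for $t>0$. -/
lemma norm_sub_le_of_hasDerivAt {φ φ₁ : ℝ → F} {H B : ℝ} (hc : ContinuousOn φ (Icc 0 H))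
    (hd : ∀ t, 0 < t → t ≤ H → HasDerivAt φ (φ₁ t) t)
    (hb : ∀ t, 0 < t → t ≤ H → ‖φ₁ t‖ ≤ B) {h : ℝ} (h0 : 0 ≤ h) (hH : h ≤ H) :
    ‖φ h - φ 0‖ ≤ B * h := by
  rcases h0.eq_or_lt with rfl | h0
  · simp
  have h1 : ∀ δ ∈ Ioc 0 h, ‖φ h - φ δ‖ ≤ B * (h - δ) := by
    intro δ hδ
    have := Convex.norm_image_sub_le_of_norm_hasDerivWithin_le (f := φ) (f' := φ₁)
      (s := Icc δ h) (C := B) (x := δ) (y := h)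
      (fun t ht => (hd t (hδ.1.trans_le ht.1) (ht.2.trans hH)).hasDerivWithinAt)
      (fun t ht => hb t (hδ.1.trans_le ht.1) (ht.2.trans hH)) (convex_Icc _ _)
      (left_mem_Icc.2 hδ.2) (right_mem_Icc.2 hδ.2)
    rwa [Real.norm_of_nonneg (sub_nonneg.2 hδ.2)] at this
  have hlim : Tendsto φ (𝓝[Ioc 0 h] 0) (𝓝 (φ 0)) :=
    (hc 0 ⟨le_rfl, h0.le.trans hH⟩).mono_left
      (nhdsWithin_mono _ fun t ht => ⟨ht.1.le, ht.2.trans hH⟩)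
  have hne : (𝓝[Ioc 0 h] (0 : ℝ)).NeBot := by
    rw [← mem_closure_iff_nhdsWithin_neBot, closure_Ioc h0.ne]
    exact ⟨le_rfl, h0.le⟩
  have hl : Tendsto (fun δ => ‖φ h - φ δ‖) (𝓝[Ioc 0 h] 0) (𝓝 ‖φ h - φ 0‖) :=
    (tendsto_const_nhds.sub hlim).norm
  have hr : Tendsto (fun δ => B * (h - δ)) (𝓝[Ioc 0 h] 0) (𝓝 (B * (h - 0))) :=
    Tendsto.mono_left (Continuous.tendsto (by fun_prop) 0) nhdsWithin_le_nhds
  rw [sub_zero] at hr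
  exact le_of_tendsto_of_tendsto hl hr (eventually_nhdsWithin_of_forall h1)

/-- The first-order bound is applied twice, first to $\varphi_1$ and then to
$\varphi-t\varphi_1(0)$. The constant is not sharp; only the order in $h$ matters later. -/
lemma norm_taylor_two_le {φ φ₁ φ₂ : ℝ → F} {H B : ℝ} (hc : ContinuousOn φ (Icc 0 H))
    (hc₁ : ContinuousOn φ₁ (Icc 0 H))
    (hd : ∀ t, 0 < t → t ≤ H → HasDerivAt φ (φ₁ t) t)
    (hd₁ : ∀ t, 0 < t → t ≤ H → HasDerivAt φ₁ (φ₂ t) t)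
    (hb : ∀ t, 0 < t → t ≤ H → ‖φ₂ t‖ ≤ B) {h : ℝ} (h0 : 0 ≤ h) (hH : h ≤ H) :
    ‖φ h - φ 0 - h • φ₁ 0‖ ≤ B * h ^ 2 := by
  rcases h0.eq_or_lt with rfl | h0'
  · simp
  have hB : 0 ≤ B := (norm_nonneg _).trans (hb h h0' hH)
  have hsub : Icc 0 h ⊆ Icc 0 H := Icc_subset_Icc_right hH
  have key := norm_sub_le_of_hasDerivAt (φ := fun t => φ t - t • φ₁ 0)
    (φ₁ := fun t => φ₁ t - φ₁ 0) (H := h) (B := B * h)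
    ((hc.mono hsub).sub (by fun_prop))
    (fun t ht hth => by
      have := (hd t ht (hth.trans hH)).fun_sub ((hasDerivAt_id t).smul_const (φ₁ 0))
      simpa using this)
    (fun t ht hth => (norm_sub_le_of_hasDerivAt (hc₁.mono hsub)
      (fun t ht hth => hd₁ t ht (hth.trans hH)) (fun t ht hth => hb t ht (hth.trans hH)) ht.le
      hth).trans (by gcongr)) h0 le_rfl
  calc ‖φ h - φ 0 - h • φ₁ 0‖ = ‖φ h - h • φ₁ 0 - (φ 0 - (0 : ℝ) • φ₁ 0)‖ := by
        congr 1; module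
    _ ≤ B * h * h := key
    _ = B * h ^ 2 := by ring

lemma norm_taylor_three_le {φ φ₁ φ₂ φ₃ : ℝ → F} {H B : ℝ} (hc : ContinuousOn φ (Icc 0 H))
    (hc₁ : ContinuousOn φ₁ (Icc 0 H)) (hc₂ : ContinuousOn φ₂ (Icc 0 H))
    (hd : ∀ t, 0 < t → t ≤ H → HasDerivAt φ (φ₁ t) t)
    (hd₁ : ∀ t, 0 < t → t ≤ H → HasDerivAt φ₁ (φ₂ t) t)
    (hd₂ : ∀ t, 0 < t → t ≤ H → HasDerivAt φ₂ (φ₃ t) t)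
    (hb : ∀ t, 0 < t → t ≤ H → ‖φ₃ t‖ ≤ B) {h : ℝ} (h0 : 0 ≤ h) (hH : h ≤ H) :
    ‖φ h - φ 0 - h • φ₁ 0 - (h ^ 2 / 2) • φ₂ 0‖ ≤ B * h ^ 3 := by
  rcases h0.eq_or_lt with rfl | h0'
  · simp
  have hB : 0 ≤ B := (norm_nonneg _).trans (hb h h0' hH)
  have hsub : Icc 0 h ⊆ Icc 0 H := Icc_subset_Icc_right hH
  have key := norm_sub_le_of_hasDerivAt (φ := fun t => φ t - t • φ₁ 0 - (t ^ 2 / 2) • φ₂ 0)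
    (φ₁ := fun t => φ₁ t - φ₁ 0 - t • φ₂ 0) (H := h) (B := B * h ^ 2)
    (((hc.mono hsub).sub (by fun_prop)).sub (by fun_prop))
    (fun t ht hth => by
      have h2 : HasDerivAt (fun t : ℝ => t ^ 2 / 2) t t := by
        have := (hasDerivAt_pow 2 t).div_const 2
        simpa using this
      have := ((hd t ht (hth.trans hH)).fun_sub ((hasDerivAt_id t).smul_const (φ₁ 0))).fun_sub
        (h2.smul_const (φ₂ 0))
      simpa using this)
    (fun t ht hth => (norm_taylor_two_le (hc₁.mono hsub) (hc₂.mono hsub)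
      (fun t ht hth => hd₁ t ht (hth.trans hH)) (fun t ht hth => hd₂ t ht (hth.trans hH))
      (fun t ht hth => hb t ht (hth.trans hH)) ht.le hth).trans (by gcongr)) h0 le_rfl
  calc ‖φ h - φ 0 - h • φ₁ 0 - (h ^ 2 / 2) • φ₂ 0‖
      = ‖φ h - h • φ₁ 0 - (h ^ 2 / 2) • φ₂ 0
          - (φ 0 - (0 : ℝ) • φ₁ 0 - ((0 : ℝ) ^ 2 / 2) • φ₂ 0)‖ := by
        congr 1; module
    _ ≤ B * h ^ 2 * h := key
    _ = B * h ^ 3 := by ring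

end Taylor

set_option linter.unusedSectionVars false

/-! ### Uniform $O(t^j)$ calculus and expansions of the heat semigroup. -/

section BigO

variable {d : ℕ} {ι : Type*} {F G : Type*} [NormedAddCommGroup F] [NormedSpace ℝ F]
  [NormedAddCommGroup G] [NormedSpace ℝ G]

/-- `a p t x` is `O(t^j)`, uniformly in `p`, in `x` and in `t ∈ [0, H]`. -/
def UnifO (H : ℝ) (j : ℕ) (a : ι → ℝ → Sp d → F) : Prop :=
  ∃ C, 0 ≤ C ∧ ∀ p t, 0 ≤ t → t ≤ H → ∀ x, ‖a p t x‖ ≤ C * t ^ j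

lemma UnifO.add {H : ℝ} {j : ℕ} {a b : ι → ℝ → Sp d → F} (ha : UnifO H j a) (hb : UnifO H j b) :
    UnifO H j (fun p t x => a p t x + b p t x) := by
  obtain ⟨C, hC0, hC⟩ := ha
  obtain ⟨C', hC0', hC'⟩ := hb
  refine ⟨C + C', by positivity, fun p t h0 h1 x => (norm_add_le _ _).trans ?_⟩
  linarith [hC p t h0 h1 x, hC' p t h0 h1 x]

lemma UnifO.smul_pow {H : ℝ} {j : ℕ} {a : ι → ℝ → Sp d → F} (ha : UnifO H j a) (c : ℝ) (i : ℕ) :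
    UnifO H (i + j) (fun p t x => (c * t ^ i) • a p t x) := by
  obtain ⟨C, hC0, hC⟩ := ha
  refine ⟨|c| * C, by positivity, fun p t h0 h1 x => ?_⟩
  rw [norm_smul, norm_mul, Real.norm_eq_abs, Real.norm_of_nonneg (by positivity), pow_add]
  calc |c| * t ^ i * ‖a p t x‖ ≤ |c| * t ^ i * (C * t ^ j) := by gcongr; exact hC p t h0 h1 x
    _ = _ := by ring

lemma UnifO.congr {H : ℝ} {j : ℕ} {a b : ι → ℝ → Sp d → F} (ha : UnifO H j a)
    (h : ∀ p t, 0 ≤ t → t ≤ H → ∀ x, b p t x = a p t x) : UnifO H j b := by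
  obtain ⟨C, hC0, hC⟩ := ha
  exact ⟨C, hC0, fun p t h0 h1 x => by rw [h p t h0 h1 x]; exact hC p t h0 h1 x⟩

lemma UnifO.of_norm_le {H : ℝ} {j : ℕ} {a : ι → ℝ → Sp d → F} {b : ι → ℝ → Sp d → G} {K : ℝ}
    (ha : UnifO H j a) (hK : 0 ≤ K)
    (h : ∀ p t, 0 ≤ t → t ≤ H → ∀ x, ‖b p t x‖ ≤ K * ‖a p t x‖) : UnifO H j b := by
  obtain ⟨C, hC0, hC⟩ := ha
  refine ⟨K * C, by positivity, fun p t h0 h1 x => (h p t h0 h1 x).trans ?_⟩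
  rw [mul_assoc]
  exact mul_le_mul_of_nonneg_left (hC p t h0 h1 x) hK

lemma UnifO.heatOp {H : ℝ} {j : ℕ} {a : ι → ℝ → Sp d → F} (ha : UnifO H j a) (κ : ℝ) :
    UnifO H j (fun p t => heatOp (κ * t) (a p t)) := by
  obtain ⟨C, hC0, hC⟩ := ha
  exact ⟨C, hC0, fun p t h0 h1 x => norm_heatOp_le (hC p t h0 h1) _ _⟩

lemma UnifC.unifO {k : ℕ} {v : ι → Sp d → F} (hv : UnifC k v) (H : ℝ) :
    UnifO H 0 (fun p _ x => v p x) := by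
  obtain ⟨B, hB0, hB⟩ := hv.bound
  exact ⟨B, hB0, fun p t _ _ x => by simpa using hB p x⟩

lemma hasDerivAt_heatOp_mul {k : ℕ} {v : ι → Sp d → F} (hv : UnifC (k + 2) v) {κ : ℝ}
    (hκ : 0 < κ) (p : ι) (x : Sp d) {t : ℝ} (ht : 0 < t) :
    HasDerivAt (fun t => heatOp (κ * t) (v p) x) (κ • heatOp (κ * t) (lap (v p)) x) t := by
  obtain ⟨B, hB⟩ := hv
  have h2 := (hB p).mono (l := 2) (by omega) le_rfl
  have h := hasDerivAt_heatOp (by exact_mod_cast h2.1) h2.2 (mul_pos hκ ht) x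
  have h' : HasDerivAt (fun t : ℝ => κ * t) κ t := by
    simpa using (hasDerivAt_id t).const_mul κ
  exact h.scomp t h'

lemma continuous_heatOp_mul {k : ℕ} {v : ι → Sp d → F} (hv : UnifC k v) (κ : ℝ) (p : ι)
    (x : Sp d) : Continuous (fun t => heatOp (κ * t) (v p) x) := by
  obtain ⟨B, hB0, hB⟩ := hv.bound
  exact (continuous_heatOp (hv.continuous p) (hB p)).comp
    (Continuous.prodMk (by fun_prop) continuous_const)

variable [CompleteSpace F]

lemma heatOp_taylor_one {v : ι → Sp d → F} (hv : UnifC 2 v) {κ : ℝ} (hκ : 0 < κ) (H : ℝ) :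
    UnifO H 1 (fun p t x => heatOp (κ * t) (v p) x - v p x) := by
  obtain ⟨B, hB0, hB⟩ := (UnifC.lap (k := 0) hv).bound
  refine ⟨κ * B, by positivity, fun p t h0 h1 x => ?_⟩
  have := norm_sub_le_of_hasDerivAt (φ := fun t => heatOp (κ * t) (v p) x) (H := H) (B := κ * B)
    (continuous_heatOp_mul hv κ p x).continuousOn
    (fun t ht _ => hasDerivAt_heatOp_mul (k := 0) hv hκ p x ht)
    (fun t ht _ => by
      rw [norm_smul, Real.norm_of_nonneg hκ.le]
      exact mul_le_mul_of_nonneg_left (norm_heatOp_le (hB p) _ _) hκ.le) h0 h1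
  simpa [heatOp_zero] using this

lemma heatOp_taylor_two {v : ι → Sp d → F} (hv : UnifC 4 v) {κ : ℝ} (hκ : 0 < κ) (H : ℝ) :
    UnifO H 2 (fun p t x => heatOp (κ * t) (v p) x - v p x - (t * κ) • lap (v p) x) := by
  have hv2 := UnifC.lap (k := 2) hv
  obtain ⟨B, hB0, hB⟩ := (UnifC.lap (k := 0) hv2).bound
  refine ⟨κ * (κ * B), by positivity, fun p t h0 h1 x => ?_⟩
  have := norm_taylor_two_le (φ := fun t => heatOp (κ * t) (v p) x) (H := H) (B := κ * (κ * B))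
    (continuous_heatOp_mul hv κ p x).continuousOn
    ((continuous_heatOp_mul hv2 κ p x).const_smul κ).continuousOn
    (fun t ht _ => hasDerivAt_heatOp_mul (k := 2) hv hκ p x ht)
    (fun t ht _ => (hasDerivAt_heatOp_mul (k := 0) hv2 hκ p x ht).const_smul κ)
    (fun t ht _ => by
      rw [norm_smul, norm_smul, Real.norm_of_nonneg hκ.le]
      gcongr
      exact norm_heatOp_le (hB p) _ _) h0 h1
  simpa [heatOp_zero, smul_smul] using this

/-- Each time derivative of the semigroup is a Laplacian of the initial value, so the third-order
remainder is controlled by six space derivatives; contractivity makes the bound independent of $t$.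
-/
lemma heatOp_taylor_three {v : ι → Sp d → F} (hv : UnifC 6 v) {κ : ℝ} (hκ : 0 < κ) (H : ℝ) :
    UnifO H 3 (fun p t x => heatOp (κ * t) (v p) x - v p x - (t * κ) • lap (v p) x
      - (t ^ 2 / 2 * κ ^ 2) • lap (lap (v p)) x) := by
  have hv2 := UnifC.lap (k := 4) hv
  have hv4 := UnifC.lap (k := 2) hv2
  obtain ⟨B, hB0, hB⟩ := (UnifC.lap (k := 0) hv4).bound
  refine ⟨κ * (κ * (κ * B)), by positivity, fun p t h0 h1 x => ?_⟩
  have := norm_taylor_three_le (φ := fun t => heatOp (κ * t) (v p) x) (H := H)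
    (B := κ * (κ * (κ * B)))
    (continuous_heatOp_mul hv κ p x).continuousOn
    ((continuous_heatOp_mul hv2 κ p x).const_smul κ).continuousOn
    (((continuous_heatOp_mul hv4 κ p x).const_smul κ).const_smul κ).continuousOn
    (fun t ht _ => hasDerivAt_heatOp_mul (k := 4) hv hκ p x ht)
    (fun t ht _ => (hasDerivAt_heatOp_mul (k := 2) hv2 hκ p x ht).const_smul κ)
    (fun t ht _ => ((hasDerivAt_heatOp_mul (k := 0) hv4 hκ p x ht).const_smul κ).const_smul κ)
    (fun t ht _ => by
      rw [norm_smul, norm_smul, norm_smul, Real.norm_of_nonneg hκ.le]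
      gcongr
      exact norm_heatOp_le (hB p) _ _) h0 h1
  simpa [heatOp_zero, smul_smul, sq, mul_assoc] using this

end BigO

/-! ### Periodic functions and first and second order conditions at a maximum. -/

section MaximumPrinciple

variable {d : ℕ} {F G : Type*}

/-- `2π`-periodicity in each coordinate, for functions with arbitrary values. -/
def PerFun (g : Sp d → F) : Prop :=
  ∀ l : Fin d, Function.Periodic g (EuclideanSpace.single l (2 * Real.pi))

lemma PerFun.comp {g : Sp d → F} (h : PerFun g) (Q : F → G) : PerFun (fun x => Q (g x)) :=
  fun l x => congrArg Q (h l x)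

lemma PerFun.comp₂ {F' : Type*} {g : Sp d → F} {g' : Sp d → F'} (h : PerFun g) (h' : PerFun g')
    (Q : F → F' → G) : PerFun (fun x => Q (g x) (g' x)) :=
  fun l x => by
    change Q (g _) (g' _) = _
    rw [h l x, h' l x]

lemma exists_mem_cell (x : Sp d) :
    ∃ y ∈ cell d, ∀ g : Sp d → F, PerFun g → g x = g y := by
  set n : Fin d → ℤ := fun l => toIcoDiv Real.two_pi_pos (-Real.pi) (x l)
  refine ⟨x - ∑ l, n l • EuclideanSpace.single l (2 * Real.pi), fun i => ?_, fun g hg => ?_⟩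
  · have h1 : (x - ∑ l, n l • EuclideanSpace.single l (2 * Real.pi) : Sp d) i
        = toIcoMod Real.two_pi_pos (-Real.pi) (x i) := by
      rw [toIcoMod]
      simp [Finset.sum_apply, n, Pi.single_apply]
    rw [h1]
    have := toIcoMod_mem_Ico Real.two_pi_pos (-Real.pi) (x i)
    exact ⟨this.1, by linarith [this.2]⟩
  · have h : ∀ s : Finset (Fin d), Function.Periodic g
        (∑ l ∈ s, n l • EuclideanSpace.single l (2 * Real.pi)) := by
      intro s
      induction s using Finset.induction_on with
      | empty => intro x; simp
      | insert a s ha ih =>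
        rw [Finset.sum_insert ha]
        exact ((hg a).zsmul (n a)).add_period ih
    exact (h Finset.univ).sub_eq x |>.symm

lemma isCompact_cell (d : ℕ) : IsCompact (cell d) := by
  have h : cell d = (EuclideanSpace.equiv (Fin d) ℝ).toHomeomorph ⁻¹'
      (Set.pi univ fun _ => Icc (-Real.pi) Real.pi) := by
    ext x
    exact ⟨fun h i _ => h i, fun h i => h i (mem_univ i)⟩
  rw [h, Homeomorph.isCompact_preimage]
  exact isCompact_univ_pi fun _ => isCompact_Icc

lemma zero_mem_cell (d : ℕ) : (0 : Sp d) ∈ cell d := fun i => by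
  have := Real.pi_pos
  constructor <;> simp [this.le]

lemma PerFun.exists_bound [NormedAddCommGroup F] {g : Sp d → F} (hg : PerFun g)
    (hc : Continuous g) : ∃ B, ∀ x, ‖g x‖ ≤ B := by
  obtain ⟨B, hB⟩ := (isCompact_cell d).exists_bound_of_continuousOn hc.continuousOn
  refine ⟨B, fun x => ?_⟩
  obtain ⟨y, hy, h⟩ := exists_mem_cell (F := F) x
  rw [h g hg]; exact hB y hy

variable [NormedAddCommGroup F] [NormedSpace ℝ F] [NormedAddCommGroup G] [NormedSpace ℝ G]

lemma PerFun.fderiv {g : Sp d → F} (h : PerFun g) : PerFun (fderiv ℝ g) := fun l x => by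
  rw [← fderiv_comp_add_right]
  congr 1
  funext y; exact h l y

lemma PerFun.iteratedFDeriv {g : Sp d → F} (h : PerFun g) (i : ℕ) :
    PerFun (iteratedFDeriv ℝ i g) := fun l x => by
  rw [← iteratedFDeriv_comp_add_right]
  congr 1
  funext y; exact h l y

lemma PerFun.lap {g : Sp d → F} (h : PerFun g) : PerFun (lap g) := by
  have := (PerFun.fderiv (PerFun.fderiv h)).comp (bilinTrace d F)
  intro l x
  rw [lap_eq_bilinTrace, lap_eq_bilinTrace]
  exact this l x

lemma PerFun.heatOp {g : Sp d → F} (h : PerFun g) (s : ℝ) : PerFun (heatOp s g) := fun l x => by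
  unfold MAC.heatOp
  congr 1; funext y
  rw [add_sub_right_comm, h l]

lemma PerFun.exists_bddC {g : Sp d → F} (h : PerFun g) {k : ℕ} (hg : ContDiff ℝ k g) :
    ∃ B, BddC k B g := by
  have h1 : ∀ i : Fin (k + 1), ∃ C, ∀ x, ‖_root_.iteratedFDeriv ℝ i g x‖ ≤ C := fun i =>
    (h.iteratedFDeriv i).exists_bound
      (hg.continuous_iteratedFDeriv (by exact_mod_cast Nat.lt_succ_iff.1 i.2))
  choose C hC using h1
  refine ⟨∑ i, |C i|, hg, fun i hi x => ?_⟩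
  refine ((hC ⟨i, Nat.lt_succ_of_le hi⟩ x).trans (le_abs_self _)).trans ?_
  exact Finset.single_le_sum (f := fun i => |C i|) (fun i _ => abs_nonneg _) (Finset.mem_univ _)

lemma lap_clm_comp (L : F →L[ℝ] G) {g : Sp d → F} (hg : ContDiff ℝ 2 g) (x : Sp d) :
    lap (fun y => L (g y)) x = L (lap g x) := by
  have hg1 : Differentiable ℝ g := hg.differentiable two_ne_zero
  have hg2 : Differentiable ℝ (_root_.fderiv ℝ g) :=
    (contDiff_fderiv_of_succ (k := 1) hg).differentiable one_ne_zero
  have e : _root_.fderiv ℝ (fun y => L (g y)) = fun y => L.comp (_root_.fderiv ℝ g y) := by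
    funext y; exact (L.hasFDerivAt.comp y (hg1 y).hasFDerivAt).fderiv
  have e2 : _root_.fderiv ℝ (fun y => L.comp (_root_.fderiv ℝ g y)) x
      = (ContinuousLinearMap.compL ℝ (Sp d) F G L).comp
        (_root_.fderiv ℝ (_root_.fderiv ℝ g) x) :=
    ((ContinuousLinearMap.compL ℝ (Sp d) F G L).hasFDerivAt.comp x (hg2 x).hasFDerivAt).fderiv
  simp only [lap, e, e2, map_sum]
  rfl

lemma lap_sub {g h : Sp d → F} (hg : ContDiff ℝ 2 g) (hh : ContDiff ℝ 2 h) (x : Sp d) :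
    lap (fun y => g y - h y) x = lap g x - lap h x := by
  have e : (fun y => g y - h y) = fun y => g y + (-1 : ℝ) • h y := by
    funext y; module
  rw [e, lap_add hg (hh.const_smul _), lap_const_smul _ hh]
  module

/-- The second derivative test is applied on each coordinate line through the maximum. -/
lemma lap_nonpos_of_forall_le {φ : Sp d → ℝ} (hφ : ContDiff ℝ 2 φ) {x₀ : Sp d}
    (hmax : ∀ x, φ x ≤ φ x₀) : lap φ x₀ ≤ 0 := by
  refine Finset.sum_nonpos fun i _ => ?_
  set e : Sp d := EuclideanSpace.single i 1
  set ψ : ℝ → ℝ := fun r => φ (x₀ + r • e)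
  have hline : ∀ r : ℝ, HasDerivAt (fun r : ℝ => x₀ + r • e) e r := fun r => by
    simpa using ((hasDerivAt_id r).smul_const e).const_add x₀
  have h1 : ∀ r, HasDerivAt ψ (_root_.fderiv ℝ φ (x₀ + r • e) e) r := fun r =>
    (hφ.differentiable two_ne_zero _).hasFDerivAt.comp_hasDerivAt r (hline r)
  have h1' : deriv ψ = fun r => _root_.fderiv ℝ φ (x₀ + r • e) e := funext fun r => (h1 r).deriv
  have h2 : HasDerivAt (deriv ψ) (_root_.fderiv ℝ (_root_.fderiv ℝ φ) x₀ e e) 0 := by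
    rw [h1']
    have h := (fderiv_fderiv_apply hφ e (x₀ + (0 : ℝ) • e)).comp_hasDerivAt 0 (hline 0)
    simp only [zero_smul, add_zero] at h
    exact h
  have hm : IsLocalMax ψ 0 := Eventually.of_forall fun r => by simpa [ψ] using hmax _
  by_contra hcon
  push Not at hcon
  -- If the second derivative were positive, the maximum would also be a local minimum, so `ψ` would
  -- be locally constant and its second derivative zero.
  have hmin : IsLocalMin ψ 0 :=
    isLocalMin_of_deriv_deriv_pos (by rw [h2.deriv]; exact hcon) hm.deriv_eq_zero
      (h1 0).continuousAt
  have hconst : ψ =ᶠ[𝓝 0] fun _ => ψ 0 := by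
    filter_upwards [hm, hmin] with r hr hr' using le_antisymm hr hr'
  have h3 : deriv ψ =ᶠ[𝓝 0] fun _ => 0 := by
    have := hconst.deriv
    simpa using this
  have h4 := h3.deriv_eq
  rw [h2.deriv, deriv_const] at h4
  exact hcon.ne' h4

/-- Slopes from the left are nonnegative. Only earlier times are compared, so the maximum may sit at
the final time. -/
lemma hasDerivAt_nonneg_of_forall_le {χ : ℝ → ℝ} {c t₀ : ℝ} (ht₀ : 0 < t₀)
    (hd : HasDerivAt χ c t₀) (h : ∀ t, 0 ≤ t → t ≤ t₀ → χ t ≤ χ t₀) : 0 ≤ c := by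
  have h1 := (hasDerivWithinAt_iff_tendsto_slope' (s := Iio t₀) (by simp)).1
    hd.hasDerivWithinAt
  have h2 : ∀ᶠ t in 𝓝[<] t₀, 0 ≤ slope χ t₀ t := by
    filter_upwards [Ioo_mem_nhdsLT ht₀] with t ht
    rw [slope_def_field]
    exact div_nonneg_of_nonpos (sub_nonpos.2 (h t ht.1.le ht.2.le)) (sub_nonpos.2 ht.2.le)
  exact ge_of_tendsto h1 h2

end MaximumPrinciple

/-! ### Comparison of a solution with an approximate solution. -/

section Comparison

variable {d : ℕ} {F : Type*} [NormedAddCommGroup F] [InnerProductSpace ℝ F]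

/-- At a maximum point of $|U-P|/\rho$ the difference is frozen to a vector $z$ and tested against:
the scalar function $\langle z,U-P\rangle$ attains its spatial maximum there, so diffusion does not
help growth, and the one-sided Lipschitz bound on `f` controls the reaction. The nonsmooth norm is
never differentiated. -/
theorem norm_sub_le_of_residual {f : F → F}
    (hf : ∀ a b, inner ℝ (f a - f b) (a - b) ≤ ‖a - b‖ ^ 2) {κ τ δ r : ℝ} (hκ : 0 ≤ κ)
    (hδ : 0 ≤ δ) (hr : 0 ≤ r) {U P P' : ℝ → Sp d → F}
    (hUc : ContinuousOn (fun p : ℝ × Sp d => U p.1 p.2) (Icc 0 τ ×ˢ univ))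
    (hPc : ContinuousOn (fun p : ℝ × Sp d => P p.1 p.2) (Icc 0 τ ×ˢ univ))
    (hUp : ∀ t, 0 ≤ t → t ≤ τ → PerFun (U t)) (hPp : ∀ t, 0 ≤ t → t ≤ τ → PerFun (P t))
    (hU2 : ∀ t, 0 < t → t ≤ τ → ContDiff ℝ 2 (U t))
    (hP2 : ∀ t, 0 < t → t ≤ τ → ContDiff ℝ 2 (P t))
    (hUd : ∀ t, 0 < t → t ≤ τ → ∀ x,
      HasDerivAt (fun s => U s x) (κ • lap (U t) x + f (U t x)) t)
    (hPd : ∀ t, 0 < t → t ≤ τ → ∀ x, HasDerivAt (fun s => P s x) (P' t x) t)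
    (hres : ∀ t, 0 < t → t ≤ τ → ∀ x, ‖P' t x - κ • lap (P t) x - f (P t x)‖ ≤ r)
    (h0 : ∀ x, ‖U 0 x - P 0 x‖ ≤ δ) {t : ℝ} (ht : 0 ≤ t) (htτ : t ≤ τ) (x : Sp d) :
    ‖U t x - P t x‖ ≤ Real.exp t * (δ + r * t) := by
  -- The small $\eta$ makes $\rho$ positive even for $\delta=r=0$ and makes it a strict
  -- supersolution: $\rho'=\rho+e^t(r+\eta)$.
  have main : ∀ η > 0, ‖U t x - P t x‖ ≤ Real.exp t * (δ + η + (r + η) * t) := by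
    intro η hη
    set ρ : ℝ → ℝ := fun t => Real.exp t * (δ + η + (r + η) * t)
    have hρpos : ∀ t, 0 ≤ t → 0 < ρ t := fun t ht => by positivity
    have hρd : ∀ t, HasDerivAt ρ (ρ t + Real.exp t * (r + η)) t := fun t => by
      have h1 : HasDerivAt (fun t => δ + η + (r + η) * t) (r + η) t := by
        simpa using ((hasDerivAt_id t).const_mul (r + η)).const_add (δ + η)
      exact (Real.hasDerivAt_exp t).mul h1
    set K : Set (ℝ × Sp d) := Icc 0 τ ×ˢ cell d
    have hK : IsCompact K := isCompact_Icc.prod (isCompact_cell d)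
    have hKne : K.Nonempty := ⟨(t, 0), ⟨ht, htτ⟩, zero_mem_cell d⟩
    have hKsub : K ⊆ Icc 0 τ ×ˢ univ := prod_mono le_rfl (subset_univ _)
    have hcont : ContinuousOn (fun p : ℝ × Sp d => ‖U p.1 p.2 - P p.1 p.2‖ / ρ p.1) K := by
      refine ContinuousOn.div ((hUc.mono hKsub).sub (hPc.mono hKsub)).norm ?_ ?_
      · exact Continuous.continuousOn (by fun_prop)
      · rintro p ⟨hp, -⟩; exact (hρpos _ hp.1).ne'
    obtain ⟨⟨t₀, x₀⟩, ⟨ht₀, hx₀⟩, hmax⟩ := hK.exists_isMaxOn hKne hcont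
    set z : F := U t₀ x₀ - P t₀ x₀
    set q : ℝ := ‖z‖ / ρ t₀
    have ht₀' : t₀ ∈ Icc 0 τ := ht₀
    have hzq : ‖z‖ = q * ρ t₀ := by
      rw [div_mul_cancel₀]; exact (hρpos _ ht₀'.1).ne'
    have hall : ∀ s, 0 ≤ s → s ≤ τ → ∀ y, ‖U s y - P s y‖ ≤ q * ρ s := by
      intro s hs hsτ y
      obtain ⟨y', hy', hyy⟩ := exists_mem_cell (F := F) y
      have h1 : U s y - P s y = U s y' - P s y' :=
        hyy _ (PerFun.comp₂ (hUp s hs hsτ) (hPp s hs hsτ) (fun a b => a - b))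
      have h2 : ‖U s y' - P s y'‖ / ρ s ≤ q := hmax (⟨⟨hs, hsτ⟩, hy'⟩ : (s, y') ∈ K)
      rw [h1]
      exact (div_le_iff₀ (hρpos s hs)).1 h2
    have hq : q ≤ 1 := by
      by_contra hq
      push Not at hq
      have ht₀pos : 0 < t₀ := by
        rcases ht₀'.1.eq_or_lt with h | h
        · exfalso
          have h1 : ‖z‖ ≤ δ := by
            have := h0 x₀
            simpa only [z, ← h] using this
          have h2 : ρ t₀ = δ + η := by simp [ρ, ← h]
          rw [hzq, h2] at h1
          nlinarith
        · exact h
      have hzpos : 0 < ‖z‖ := by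
        rw [hzq]; exact mul_pos (by linarith) (hρpos _ ht₀'.1)
      have hU2' := hU2 t₀ ht₀pos ht₀'.2
      have hP2' := hP2 t₀ ht₀pos ht₀'.2
      have hlap : inner ℝ z (lap (U t₀) x₀ - lap (P t₀) x₀) ≤ 0 := by
        have h1 := lap_nonpos_of_forall_le (φ := fun y => innerSL ℝ z (U t₀ y - P t₀ y))
          ((innerSL ℝ z).contDiff.comp (hU2'.sub hP2')) (x₀ := x₀) (fun y => by
            simp only [innerSL_apply_apply]
            calc inner ℝ z (U t₀ y - P t₀ y) ≤ ‖z‖ * ‖U t₀ y - P t₀ y‖ :=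
                  real_inner_le_norm _ _
              _ ≤ ‖z‖ * ‖z‖ := by
                  gcongr; rw [hzq]; exact hall t₀ ht₀'.1 ht₀'.2 y
              _ = inner ℝ z (U t₀ x₀ - P t₀ x₀) := (real_inner_self_eq_norm_mul_norm z).symm)
        rw [lap_clm_comp _ (hU2'.sub hP2'), lap_sub hU2' hP2'] at h1
        simpa using h1
      have hUd' := hUd t₀ ht₀pos ht₀'.2 x₀
      have hPd' := hPd t₀ ht₀pos ht₀'.2 x₀
      -- This function vanishes at $t_0$ and is nonpositive at earlier times by Cauchy-Schwarz,
      -- hence its derivative at $t_0$ is nonnegative.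
      have hχ : HasDerivAt (fun s => inner ℝ z (U s x₀ - P s x₀) - ‖z‖ * (q * ρ s))
          (inner ℝ z (κ • lap (U t₀) x₀ + f (U t₀ x₀) - P' t₀ x₀)
            - ‖z‖ * (q * (ρ t₀ + Real.exp t₀ * (r + η)))) t₀ := by
        have h1 : HasDerivAt (fun s => inner ℝ z (U s x₀ - P s x₀)) _ t₀ :=
          (innerSL ℝ z).hasFDerivAt.comp_hasDerivAt t₀ (hUd'.sub hPd')
        exact h1.sub (((hρd t₀).const_mul q).const_mul ‖z‖)
      have htime := hasDerivAt_nonneg_of_forall_le ht₀pos hχ (fun s hs hst => by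
        have e1 : inner ℝ z (U t₀ x₀ - P t₀ x₀) - ‖z‖ * (q * ρ t₀) = 0 := by
          rw [← hzq]
          exact sub_eq_zero.2 (real_inner_self_eq_norm_mul_norm z)
        rw [e1]
        have e2 := real_inner_le_norm z (U s x₀ - P s x₀)
        have e3 := mul_le_mul_of_nonneg_left (hall s hs (hst.trans ht₀'.2) x₀) (norm_nonneg z)
        linarith)
      have hsplit : κ • lap (U t₀) x₀ + f (U t₀ x₀) - P' t₀ x₀
          = κ • (lap (U t₀) x₀ - lap (P t₀) x₀) + (f (U t₀ x₀) - f (P t₀ x₀))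
            - (P' t₀ x₀ - κ • lap (P t₀) x₀ - f (P t₀ x₀)) := by
        module
      rw [hsplit, inner_sub_right, inner_add_right, inner_smul_right] at htime
      have e1 := mul_nonpos_of_nonneg_of_nonpos hκ hlap
      have e2 : inner ℝ z (f (U t₀ x₀) - f (P t₀ x₀)) ≤ ‖z‖ ^ 2 := by
        rw [real_inner_comm]; exact hf _ _
      have e3 : -inner ℝ z (P' t₀ x₀ - κ • lap (P t₀) x₀ - f (P t₀ x₀)) ≤ ‖z‖ * r := by
        have := neg_le_of_abs_le (abs_real_inner_le_norm z
          (P' t₀ x₀ - κ • lap (P t₀) x₀ - f (P t₀ x₀)))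
        have h5 := mul_le_mul_of_nonneg_left (hres t₀ ht₀pos ht₀'.2 x₀) (norm_nonneg z)
        linarith
      -- The term $|z|^2$ from the reaction cancels exactly against the $\rho$ part of $\rho'$. What
      -- is left forces $r+\eta\le r$ when $q>1$.
      have e4 : ‖z‖ * (q * (Real.exp t₀ * (r + η))) ≤ ‖z‖ * r := by
        have : ‖z‖ ^ 2 = ‖z‖ * (q * ρ t₀) := by rw [← hzq]; ring
        nlinarith
      have e5 : q * (Real.exp t₀ * (r + η)) ≤ r := le_of_mul_le_mul_left e4 hzpos
      have e6 : 1 ≤ Real.exp t₀ := Real.one_le_exp ht₀'.1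
      have e7 : r + η ≤ Real.exp t₀ * (r + η) := le_mul_of_one_le_left (by positivity) e6
      have e8 : Real.exp t₀ * (r + η) ≤ q * (Real.exp t₀ * (r + η)) :=
        le_mul_of_one_le_left (by positivity) hq.le
      linarith
    exact (hall t ht htτ x).trans (mul_le_of_le_one_left (hρpos t ht).le hq)
  refine le_of_forall_pos_le_add fun e he => ?_
  -- The contribution of $\eta$ to the bound is $e^t(1+t)\eta$, so this choice makes it equal to
  -- `e`.
  have hc : 0 < Real.exp t * (1 + t) := by positivity
  refine (main (e / (Real.exp t * (1 + t))) (div_pos he hc)).trans (le_of_eq ?_)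
  field_simp
  ring

end Comparison

/-! ### Square roots of positive definite matrices and trace inequalities. -/

section PosDef

open Matrix

variable {m : ℕ}

/-- Real square matrices. -/
abbrev Mat (m : ℕ) := Matrix (Fin m) (Fin m) ℝ

lemma posDef_sqrt {P : Mat m} (hP : P.PosDef) : (CFC.sqrt P).PosDef := by
  have h0 : (CFC.sqrt P).PosSemidef := Matrix.nonneg_iff_posSemidef.1 (CFC.sqrt_nonneg P)
  have h1 : CFC.sqrt P * CFC.sqrt P = P :=
    CFC.sqrt_mul_sqrt_self P (Matrix.nonneg_iff_posSemidef.2 hP.posSemidef)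
  rw [h0.posDef_iff_isUnit]
  have h2 : IsUnit (CFC.sqrt P * CFC.sqrt P) := by rw [h1]; exact hP.isUnit
  rw [Matrix.isUnit_iff_isUnit_det, Matrix.det_mul] at h2
  rw [Matrix.isUnit_iff_isUnit_det]
  exact isUnit_of_mul_isUnit_left h2

lemma sqrt_mul_sqrt_of_posDef {P : Mat m} (hP : P.PosDef) : CFC.sqrt P * CFC.sqrt P = P :=
  CFC.sqrt_mul_sqrt_self P (Matrix.nonneg_iff_posSemidef.2 hP.posSemidef)

lemma transpose_sqrt {P : Mat m} (hP : P.PosDef) : (CFC.sqrt P)ᵀ = CFC.sqrt P := by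
  have := (posDef_sqrt hP).isHermitian
  rwa [Matrix.IsHermitian, conjTranspose_eq_transpose_of_trivial] at this

lemma trace_mul_transpose_nonneg (X : Mat m) : 0 ≤ (X * Xᵀ).trace := by
  have := (Matrix.posSemidef_self_mul_conjTranspose X).trace_nonneg
  rwa [conjTranspose_eq_transpose_of_trivial] at this

/-- Uniqueness for the Sylvester equation `Q H + H Q = 0` with positive definite `Q`. -/
lemma eq_zero_of_sylvester {Q H : Mat m} (hQ : Q.PosDef) (h : Q * H + H * Q = 0) : H = 0 := by
  set B := CFC.sqrt Q
  have hB : B * B = Q := sqrt_mul_sqrt_of_posDef hQ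
  have hBt : Bᵀ = B := transpose_sqrt hQ
  -- Pairing the equation with $H$ gives $\|BH\|^2+\|BH^\top\|^2=0$ for $B=Q^{1/2}$, and $B$ is
  -- invertible.
  have h1 : (Hᵀ * (Q * H + H * Q)).trace = ((B * H)ᵀ * (B * H)).trace
      + ((B * Hᵀ)ᵀ * (B * Hᵀ)).trace := by
    rw [Matrix.mul_add, Matrix.trace_add]
    congr 1
    · rw [Matrix.transpose_mul, hBt, ← hB]; simp only [Matrix.mul_assoc]
    · rw [Matrix.transpose_mul, hBt, Matrix.transpose_transpose, ← hB, ← Matrix.mul_assoc,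
        Matrix.trace_mul_comm, ← Matrix.mul_assoc, Matrix.trace_mul_comm]
      simp only [Matrix.mul_assoc]
  rw [h, Matrix.mul_zero, Matrix.trace_zero] at h1
  have h2 : 0 ≤ ((B * H)ᵀ * (B * H)).trace := by
    simpa using trace_mul_transpose_nonneg (B * H)ᵀ
  have h3 : 0 ≤ ((B * Hᵀ)ᵀ * (B * Hᵀ)).trace := by
    simpa using trace_mul_transpose_nonneg (B * Hᵀ)ᵀ
  have h4 : ((B * H)ᵀ * (B * H)).trace = 0 := by linarith
  have h5 : B * H = 0 := by
    rw [← conjTranspose_eq_transpose_of_trivial] at h4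
    exact Matrix.trace_conjTranspose_mul_self_eq_zero_iff.1 h4
  have h6 : IsUnit B := (posDef_sqrt hQ).isUnit
  exact h6.mul_right_eq_zero.1 h5

/-- The matrix `(e^{2t} - 1) A Aᵀ + I`. -/
def regMat (t : ℝ) (A : Mat m) : Mat m := (Real.exp (2 * t) - 1) • (A * Aᵀ) + 1

lemma nonlinProp_eq (t : ℝ) (A : Mat m) :
    nonlinProp t A = (CFC.sqrt (regMat t A))⁻¹ * (Real.exp t • A) := rfl

lemma posDef_regMat {t : ℝ} (ht : 0 ≤ t) (A : Mat m) : (regMat t A).PosDef := by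
  have h1 : (A * Aᵀ).PosSemidef := by
    have := Matrix.posSemidef_self_mul_conjTranspose A
    rwa [conjTranspose_eq_transpose_of_trivial] at this
  have h2 : 0 ≤ Real.exp (2 * t) - 1 := by
    have := Real.one_le_exp (show 0 ≤ 2 * t by linarith)
    linarith
  exact Matrix.PosDef.posSemidef_add (h1.smul h2) Matrix.PosDef.one

lemma isHermitian_regMat (t : ℝ) (A : Mat m) : (regMat t A).IsHermitian := by
  rw [Matrix.IsHermitian, conjTranspose_eq_transpose_of_trivial, regMat]
  simp

lemma nonlinProp_zero (A : Mat m) : nonlinProp 0 A = A := by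
  have h : CFC.sqrt (1 : Mat m) = 1 :=
    CFC.sqrt_unique (one_mul 1) (Matrix.nonneg_iff_posSemidef.2 Matrix.PosSemidef.one)
  rw [nonlinProp_eq, regMat]
  simp [h]

lemma sqrt_mul_nonlinProp {t : ℝ} {A : Mat m} (h : (regMat t A).PosDef) :
    CFC.sqrt (regMat t A) * nonlinProp t A = Real.exp t • A := by
  rw [nonlinProp_eq, ← Matrix.mul_assoc, Matrix.mul_nonsing_inv, Matrix.one_mul]
  exact (Matrix.isUnit_iff_isUnit_det _).1 (posDef_sqrt h).isUnit

/-- With $Q$ the square root and $QN=e^tA$, one has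
$e^{2t}\|A\|^2=\operatorname{tr}(Q^2NN^\top)=\|N\|^2+(e^{2t}-1)\|A^\top N\|^2$, and the last term is
nonnegative. -/
lemma trace_nonlinProp_le {t : ℝ} (ht : 0 ≤ t) (A : Mat m) :
    (nonlinProp t A * (nonlinProp t A)ᵀ).trace ≤ Real.exp t ^ 2 * (A * Aᵀ).trace := by
  have hP := posDef_regMat ht A
  set Q := CFC.sqrt (regMat t A)
  set N := nonlinProp t A
  have hQN : Q * N = Real.exp t • A := sqrt_mul_nonlinProp hP
  have hQt : Qᵀ = Q := transpose_sqrt hP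
  have h1 : ((Q * N) * (Q * N)ᵀ).trace = (regMat t A * (N * Nᵀ)).trace := by
    rw [Matrix.transpose_mul, hQt, ← sqrt_mul_sqrt_of_posDef hP, ← Matrix.mul_assoc,
      Matrix.trace_mul_comm]
    simp only [Matrix.mul_assoc, Q]
  have h2 : (A * Aᵀ * (N * Nᵀ)).trace = ((Aᵀ * N) * (Aᵀ * N)ᵀ).trace := by
    rw [Matrix.transpose_mul, Matrix.transpose_transpose, Matrix.mul_assoc,
      Matrix.trace_mul_comm]
    simp only [Matrix.mul_assoc]
  have h3 : 0 ≤ Real.exp (2 * t) - 1 := by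
    have := Real.one_le_exp (show 0 ≤ 2 * t by linarith)
    linarith
  have h4 := mul_nonneg h3 (trace_mul_transpose_nonneg (Aᵀ * N))
  have h5 : (regMat t A * (N * Nᵀ)).trace
      = (Real.exp (2 * t) - 1) * (A * Aᵀ * (N * Nᵀ)).trace + (N * Nᵀ).trace := by
    rw [regMat, Matrix.add_mul, Matrix.trace_add, Matrix.smul_mul, Matrix.trace_smul,
      Matrix.one_mul, smul_eq_mul]
  have h6 : ((Q * N) * (Q * N)ᵀ).trace = Real.exp t ^ 2 * (A * Aᵀ).trace := by
    rw [hQN, Matrix.transpose_smul, Matrix.smul_mul, Matrix.mul_smul, smul_smul,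
      Matrix.trace_smul, smul_eq_mul, sq]
  rw [← h6, h1, h5, h2]
  linarith

/-- Twice the trace equals $\|A^\top(A-B)\|^2+\|B^\top(A-B)\|^2+\|AA^\top-BB^\top\|^2$. The identity
is checked by expanding into words of length four and identifying them under cyclic rotation and
transposition. -/
lemma trace_cubic_monotone (A B : Mat m) :
    0 ≤ ((A * Aᵀ * A - B * Bᵀ * B) * (A - B)ᵀ).trace := by
  have h1 := trace_mul_transpose_nonneg (Aᵀ * (A - B))
  have h2 := trace_mul_transpose_nonneg (Bᵀ * (A - B))
  have h3 := trace_mul_transpose_nonneg (A * Aᵀ - B * Bᵀ)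
  have c : ∀ X Y Z W : Mat m, (X * (Y * (Z * W))).trace = (Y * (Z * (W * X))).trace := by
    intro X Y Z W
    rw [Matrix.trace_mul_comm]
    simp only [Matrix.mul_assoc]
  have tr : ∀ X Y Z W : Mat m, (X * (Y * (Z * W))).trace = (Wᵀ * (Zᵀ * (Yᵀ * Xᵀ))).trace := by
    intro X Y Z W
    rw [← Matrix.trace_transpose]
    simp only [Matrix.transpose_mul, Matrix.mul_assoc]
  simp only [Matrix.transpose_sub, Matrix.transpose_mul, Matrix.transpose_transpose,
    Matrix.mul_sub, Matrix.sub_mul, Matrix.trace_sub, Matrix.mul_assoc] at h1 h2 h3 ⊢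
  have e1 := c Aᵀ A Aᵀ A
  have e2 := c Aᵀ A Bᵀ A
  have e3 := c Aᵀ B Aᵀ A
  have e4 := c Aᵀ B Bᵀ A
  have e5 := c Bᵀ A Aᵀ B
  have e6 := c Bᵀ A Bᵀ B
  have e7 := c Bᵀ B Aᵀ B
  have e8 := c Bᵀ B Bᵀ B
  have f1 := tr A Aᵀ A Bᵀ
  have f2 := tr B Bᵀ B Aᵀ
  simp only [Matrix.transpose_transpose] at f1 f2
  have g1 := c A Aᵀ A Bᵀ
  have g2 := c B Bᵀ B Aᵀ
  linarith

end PosDef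

/-! ### Smoothness of the nonlinear propagator and its differential equation. -/

section Smoothness

open Matrix

variable {m : ℕ}

attribute [local instance] Matrix.linftyOpNormedRing Matrix.linftyOpNormedAlgebra

/-- The quadratic form stays positive on the compact unit sphere under small perturbations, and
homogeneity extends this to all nonzero vectors. Symmetry is not an open condition, so it remains a
hypothesis. -/
lemma eventually_posDef {M₀ : Mat m} (h : M₀.PosDef) :
    ∀ᶠ M in 𝓝 M₀, M.IsHermitian → M.PosDef := by
  have hK : IsCompact (Metric.sphere (0 : Fin m → ℝ) 1) := isCompact_sphere 0 1
  have hc : Continuous (fun z : Mat m × (Fin m → ℝ) => z.2 ⬝ᵥ (z.1 *ᵥ z.2)) :=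
    continuous_snd.dotProduct (continuous_fst.matrix_mulVec continuous_snd)
  have hM := (Matrix.posDef_iff_dotProduct_mulVec.1 h).2
  have key := hK.eventually_forall_of_forall_eventually (x₀ := M₀)
    (P := fun M x => 0 < x ⬝ᵥ (M *ᵥ x)) (fun x hx => by
      have hx0 : x ≠ 0 := by
        rintro rfl; simp at hx
      have := hM hx0
      rw [star_trivial] at this
      exact hc.continuousAt.eventually (lt_mem_nhds this))
  filter_upwards [key] with M hM hH
  refine Matrix.posDef_iff_dotProduct_mulVec.2 ⟨hH, fun x hx => ?_⟩
  rw [star_trivial]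
  have hx' : 0 < ‖x‖ := norm_pos_iff.2 hx
  have h1 := hM (‖x‖⁻¹ • x) (by simp [norm_smul, hx'.ne'])
  rw [Matrix.mulVec_smul, smul_dotProduct, dotProduct_smul, smul_eq_mul, smul_eq_mul] at h1
  have h2 : 0 < ‖x‖⁻¹ := inv_pos.2 hx'
  exact pos_of_mul_pos_right (pos_of_mul_pos_right h1 h2.le) h2.le

lemma continuous_transpose_mat : Continuous (fun A : Mat m => Aᵀ) :=
  continuous_id.matrix_transpose

lemma contDiff_transpose_mat {n : WithTop ℕ∞} : ContDiff ℝ n (fun A : Mat m => Aᵀ) :=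
  (LinearMap.toContinuousLinearMap (Matrix.transposeLinearEquiv (Fin m) (Fin m) ℝ ℝ).toLinearMap
    : Mat m →L[ℝ] Mat m).contDiff

/-- Near a positive definite matrix, the square root of symmetric matrices extends to a smooth
function. -/
lemma exists_contDiffAt_sqrt {P₀ : Mat m} (hP : P₀.PosDef) :
    ∃ X : Mat m → Mat m, ContDiffAt ℝ (⊤ : ℕ∞) X P₀ ∧
      ∀ᶠ P in 𝓝 P₀, P.IsHermitian → X P = CFC.sqrt P := by
  set Q := CFC.sqrt P₀
  have hQ : Q.PosDef := posDef_sqrt hP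
  have hQQ : Q * Q = P₀ := sqrt_mul_sqrt_of_posDef hP
  -- The inverse function theorem for $M\mapsto M^2$ at $Q$: its derivative $H\mapsto QH+HQ$ is
  -- injective by the Sylvester lemma, hence invertible in finite dimension.
  let L : Mat m →ₗ[ℝ] Mat m := LinearMap.mulLeft ℝ Q + LinearMap.mulRight ℝ Q
  have hL : Function.Injective L := by
    rw [injective_iff_map_eq_zero]
    intro H hH
    exact eq_zero_of_sylvester hQ (by simpa [L] using hH)
  let Le : Mat m ≃L[ℝ] Mat m := (LinearEquiv.ofInjectiveEndo L hL).toContinuousLinearEquiv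
  have hsq : ContDiff ℝ (⊤ : ℕ∞) (fun M : Mat m => M * M) := by fun_prop
  have hd : HasFDerivAt (fun M : Mat m => M * M) (Le : Mat m →L[ℝ] Mat m) Q := by
    have h := (hasFDerivAt_id (𝕜 := ℝ) Q).mul' (hasFDerivAt_id Q)
    refine h.congr_fderiv ?_
    ext1 H
    change Q * H + H * Q = L H
    simp [L]
  have hn : ((⊤ : ℕ∞) : WithTop ℕ∞) ≠ 0 := by simp
  have hs := hsq.contDiffAt.hasStrictFDerivAt' hd hn
  set X := hsq.contDiffAt.localInverse hd hn with hX
  have hXc : ContDiffAt ℝ (⊤ : ℕ∞) X P₀ := by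
    have := hsq.contDiffAt.to_localInverse hd hn
    simpa only [hQQ] using this
  have hXP : X P₀ = Q := by
    have := hsq.contDiffAt.localInverse_apply_image hd hn
    simpa only [hQQ] using this
  refine ⟨X, hXc, ?_⟩
  have ht : Tendsto X (𝓝 P₀) (𝓝 Q) := by
    have := hXc.continuousAt.tendsto
    rwa [hXP] at this
  have ht' : Tendsto (fun P => (X P)ᵀ) (𝓝 P₀) (𝓝 Q) := by
    have := (continuous_transpose_mat.tendsto Q).comp ht
    rwa [transpose_sqrt hP] at this
  have hr : ∀ᶠ P in 𝓝 (Q * Q), X P * X P = P := hs.eventually_right_inverse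
  rw [hQQ] at hr
  have hl : ∀ᶠ M in 𝓝 Q, X (M * M) = M := hs.eventually_left_inverse
  filter_upwards [hr, ht'.eventually hl, ht.eventually (eventually_posDef hQ)]
    with P h1 h2 h3 hP'
  rw [Matrix.IsHermitian, conjTranspose_eq_transpose_of_trivial] at hP'
  -- For symmetric $P$ the transpose of `X P` is another root of $P$ near $Q$, so local uniqueness
  -- makes `X P` symmetric. Being near $Q$ it is positive definite, so it is the positive root.
  have h4 : (X P)ᵀ = X P := by
    rw [← h2, ← Matrix.transpose_mul, h1, hP']
  have h5 : (X P).PosDef :=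
    h3 (by rw [Matrix.IsHermitian, conjTranspose_eq_transpose_of_trivial, h4])
  exact (CFC.sqrt_unique h1 (Matrix.nonneg_iff_posSemidef.2 h5.posSemidef)).symm

lemma contDiff_regMat {n : WithTop ℕ∞} :
    ContDiff ℝ n (fun p : ℝ × Mat m => regMat p.1 p.2) := by
  have h : ContDiff ℝ n (fun p : ℝ × Mat m => p.2ᵀ) := contDiff_transpose_mat.comp contDiff_snd
  unfold regMat
  fun_prop

lemma contDiffAt_sqrt_regMat {t : ℝ} (ht : 0 ≤ t) (A : Mat m) :
    ContDiffAt ℝ (⊤ : ℕ∞) (fun p : ℝ × Mat m => CFC.sqrt (regMat p.1 p.2)) (t, A) := by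
  obtain ⟨X, hX, hX'⟩ := exists_contDiffAt_sqrt (posDef_regMat ht A)
  have hc := contDiff_regMat (m := m) (n := (⊤ : ℕ∞))
  have h1 : ContDiffAt ℝ (⊤ : ℕ∞) (fun p : ℝ × Mat m => X (regMat p.1 p.2)) (t, A) :=
    ContDiffAt.comp (t, A) (f := fun p : ℝ × Mat m => regMat p.1 p.2) hX hc.contDiffAt
  refine h1.congr_of_eventuallyEq ?_
  have h2 : Tendsto (fun p : ℝ × Mat m => regMat p.1 p.2) (𝓝 (t, A)) (𝓝 (regMat t A)) :=
    hc.continuous.tendsto (t, A)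
  filter_upwards [h2.eventually hX'] with p hp
  exact (hp (isHermitian_regMat _ _)).symm

/-- Smoothness is joint in time and matrix on a full neighbourhood, including slightly negative
times at $t=0$; this yields two-sided time derivatives there and uniform bounds by compactness. -/
lemma contDiffAt_nonlinProp {t : ℝ} (ht : 0 ≤ t) (A : Mat m) :
    ContDiffAt ℝ (⊤ : ℕ∞) (fun p : ℝ × Mat m => nonlinProp p.1 p.2) (t, A) := by
  have h1 := contDiffAt_sqrt_regMat ht A
  have hu : IsUnit (CFC.sqrt (regMat t A)) := (posDef_sqrt (posDef_regMat ht A)).isUnit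
  obtain ⟨u, hu⟩ := hu
  have h2 : ContDiffAt ℝ (⊤ : ℕ∞)
      (fun p : ℝ × Mat m => Ring.inverse (CFC.sqrt (regMat p.1 p.2))) (t, A) := by
    have h : ContDiffAt ℝ (⊤ : ℕ∞) (Ring.inverse : Mat m → Mat m) (CFC.sqrt (regMat t A)) := by
      rw [← hu]
      exact contDiffAt_ringInverse ℝ u
    exact ContDiffAt.comp (t, A) (f := fun p : ℝ × Mat m => CFC.sqrt (regMat p.1 p.2)) h h1
  have h3 : (fun p : ℝ × Mat m => nonlinProp p.1 p.2)
      = fun p => Ring.inverse (CFC.sqrt (regMat p.1 p.2)) * (Real.exp p.1 • p.2) := by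
    funext p
    rw [nonlinProp_eq, Matrix.nonsing_inv_eq_ringInverse]
  have h4 : ContDiff ℝ (⊤ : ℕ∞) (fun p : ℝ × Mat m => Real.exp p.1 • p.2) := by fun_prop
  rw [h3]
  exact h2.mul h4.contDiffAt

/-- The relations $Q^2=(e^{2t}-1)AA^\top+I$ and $QN=e^tA$ are differentiated. As $Q$ commutes with
$AA^\top$, uniqueness for the Sylvester equation gives $Q'=e^{2t}AA^\top Q^{-1}$, hence
$Q'N=QNN^\top N$ and $QN'=Q(N-NN^\top N)$. -/
lemma hasDerivAt_nonlinProp {t : ℝ} (ht : 0 ≤ t) (A : Mat m) :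
    HasDerivAt (fun s => nonlinProp s A)
      (nonlinProp t A - nonlinProp t A * (nonlinProp t A)ᵀ * nonlinProp t A) t := by
  have hP := posDef_regMat ht A
  have hline : ContDiffAt ℝ (⊤ : ℕ∞) (fun s : ℝ => (s, A)) t := by fun_prop
  have hn : ((⊤ : ℕ∞) : WithTop ℕ∞) ≠ 0 := by simp
  have hQd : DifferentiableAt ℝ (fun s => CFC.sqrt (regMat s A)) t :=
    (ContDiffAt.comp t (g := fun p : ℝ × Mat m => CFC.sqrt (regMat p.1 p.2))
      (f := fun s => (s, A)) (contDiffAt_sqrt_regMat ht A) hline).differentiableAt hn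
  have hNd : DifferentiableAt ℝ (fun s => nonlinProp s A) t :=
    (ContDiffAt.comp t (g := fun p : ℝ × Mat m => nonlinProp p.1 p.2)
      (f := fun s => (s, A)) (contDiffAt_nonlinProp ht A) hline).differentiableAt hn
  set Q := CFC.sqrt (regMat t A) with hQdef
  set N := nonlinProp t A with hNdef
  set Q' := deriv (fun s => CFC.sqrt (regMat s A)) t
  set N' := deriv (fun s => nonlinProp s A) t
  have hQ' : HasDerivAt (fun s => CFC.sqrt (regMat s A)) Q' t := hQd.hasDerivAt
  have hN' : HasDerivAt (fun s => nonlinProp s A) N' t := hNd.hasDerivAt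
  have hQpd : Q.PosDef := posDef_sqrt hP
  have hQQ : Q * Q = regMat t A := sqrt_mul_sqrt_of_posDef hP
  have hQt : Qᵀ = Q := transpose_sqrt hP
  have hdet : IsUnit Q.det := (Matrix.isUnit_iff_isUnit_det _).1 hQpd.isUnit
  have hev : ∀ᶠ s in 𝓝 t, (regMat s A).PosDef := by
    have hc : Continuous (fun s : ℝ => regMat s A) :=
      (contDiff_regMat (m := m) (n := 0)).continuous.comp (Continuous.prodMk_left A)
    filter_upwards [(hc.tendsto t).eventually (eventually_posDef hP)] with s hs
    exact hs (isHermitian_regMat _ _)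
  have hreg : HasDerivAt (fun s => regMat s A) ((2 * Real.exp (2 * t)) • (A * Aᵀ)) t := by
    have h1 : HasDerivAt (fun s : ℝ => Real.exp (2 * s) - 1) (2 * Real.exp (2 * t)) t := by
      have := ((hasDerivAt_id t).const_mul 2).exp.sub_const 1
      simpa [mul_comm] using this
    exact (h1.smul_const (A * Aᵀ)).add_const 1
  have e1 : Q' * Q + Q * Q' = (2 * Real.exp (2 * t)) • (A * Aᵀ) := by
    refine HasDerivAt.unique (hQ'.mul hQ') (hreg.congr_of_eventuallyEq ?_)
    filter_upwards [hev] with s hs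
    exact sqrt_mul_sqrt_of_posDef hs
  have e2 : Q' * N + Q * N' = Real.exp t • A := by
    have h1 : HasDerivAt (fun s => Real.exp s • A) (Real.exp t • A) t :=
      (Real.hasDerivAt_exp t).smul_const A
    refine HasDerivAt.unique (hQ'.mul hN') (h1.congr_of_eventuallyEq ?_)
    filter_upwards [hev] with s hs
    exact sqrt_mul_nonlinProp hs
  have hQN : Q * N = Real.exp t • A := sqrt_mul_nonlinProp hP
  -- $AA^\top$ commutes with $Q^2$, so the commutator of $Q$ with $AA^\top$ solves the homogeneous
  -- Sylvester equation.
  have hcomm : Q * (A * Aᵀ) = A * Aᵀ * Q := by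
    have h0 : Q * Q * (A * Aᵀ) = A * Aᵀ * (Q * Q) := by
      rw [hQQ, regMat]
      simp [Matrix.add_mul, Matrix.mul_add]
    rw [← sub_eq_zero]
    apply eq_zero_of_sylvester hQpd
    rw [Matrix.mul_sub, Matrix.sub_mul, ← Matrix.mul_assoc, h0]
    simp only [Matrix.mul_assoc]
    abel
  have hinv : Q * Q⁻¹ = 1 := Matrix.mul_nonsing_inv Q hdet
  have hinv' : Q⁻¹ * Q = 1 := Matrix.nonsing_inv_mul Q hdet
  have hQ'eq : Q' = Real.exp (2 * t) • (A * Aᵀ * Q⁻¹) := by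
    rw [← sub_eq_zero]
    apply eq_zero_of_sylvester hQpd
    have h1 : Q * (A * Aᵀ * Q⁻¹) = A * Aᵀ := by
      rw [← Matrix.mul_assoc, hcomm, Matrix.mul_assoc, hinv, Matrix.mul_one]
    have h2 : A * Aᵀ * Q⁻¹ * Q = A * Aᵀ := by
      rw [Matrix.mul_assoc, hinv', Matrix.mul_one]
    rw [Matrix.mul_sub, Matrix.sub_mul, Matrix.mul_smul, Matrix.smul_mul, h1, h2,
      show Q * Q' - Real.exp (2 * t) • (A * Aᵀ) + (Q' * Q - Real.exp (2 * t) • (A * Aᵀ))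
        = (Q' * Q + Q * Q') - (2 * Real.exp (2 * t)) • (A * Aᵀ) by module, e1, sub_self]
  have hNt : Nᵀ = Real.exp t • (Aᵀ * Q⁻¹) := by
    have h1 : Nᵀ * Q = Real.exp t • Aᵀ := by
      have := congrArg Matrix.transpose hQN
      rwa [Matrix.transpose_mul, hQt, Matrix.transpose_smul] at this
    calc Nᵀ = Nᵀ * Q * Q⁻¹ := by rw [Matrix.mul_assoc, hinv, Matrix.mul_one]
      _ = _ := by rw [h1, Matrix.smul_mul]
  have e3 : Q * N' = Q * (N - N * Nᵀ * N) := by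
    have h1 : Q * (N * Nᵀ * N) = Q' * N := by
      rw [← Matrix.mul_assoc, ← Matrix.mul_assoc, hQN, hNt, hQ'eq]
      simp only [Matrix.smul_mul, Matrix.mul_smul, smul_smul, Matrix.mul_assoc]
      rw [← Real.exp_add]
      congr 2; ring
    rw [Matrix.mul_sub, h1, hQN, ← e2]
    abel
  have e4 : N' = N - N * Nᵀ * N := hQpd.isUnit.mul_left_cancel e3
  rw [← e4]
  exact hN'

end Smoothness

/-! ### Passage to the Euclidean space of matrices. -/

section Euclidean

open Matrix

variable {m : ℕ}

/-- Matrices as a Euclidean space; its norm is the Frobenius norm. -/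
abbrev MSp (m : ℕ) := EuclideanSpace ℝ (Fin m × Fin m)

/-- The matrix with given entries. -/
def toMat : MSp m ≃ₗ[ℝ] Mat m where
  toFun a := Matrix.of fun i j => a (i, j)
  invFun A := WithLp.toLp 2 fun p => A p.1 p.2
  map_add' _ _ := rfl
  map_smul' _ _ := rfl
  left_inv _ := rfl
  right_inv _ := rfl

@[simp] lemma toMat_apply (a : MSp m) (i j : Fin m) : toMat a i j = a (i, j) := rfl

@[simp] lemma toMat_symm_apply (A : Mat m) (p : Fin m × Fin m) :
    toMat.symm A p = A p.1 p.2 := rfl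

lemma inner_eq_trace (a b : MSp m) : inner ℝ a b = (toMat a * (toMat b)ᵀ).trace := by
  simp [PiLp.inner_apply, Matrix.trace, Matrix.mul_apply, Fintype.sum_prod_type, mul_comm]

lemma norm_sq_eq_trace (a : MSp m) : ‖a‖ ^ 2 = (toMat a * (toMat a)ᵀ).trace := by
  rw [← inner_eq_trace, real_inner_self_eq_norm_sq]

lemma norm_eq_frobNorm (a : MSp m) : ‖a‖ = frobNorm (toMat a) := by
  simp [EuclideanSpace.norm_eq, frobNorm, Fintype.sum_prod_type]

/-- The reaction term `A - A Aᵀ A`. -/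
def reaction (a : MSp m) : MSp m :=
  toMat.symm (toMat a - toMat a * (toMat a)ᵀ * toMat a)

/-- The nonlinear propagator on the Euclidean space of matrices. -/
def nonlinFlow (t : ℝ) (a : MSp m) : MSp m := toMat.symm (nonlinProp t (toMat a))

lemma inner_reaction_sub_le (a b : MSp m) :
    inner ℝ (reaction a - reaction b) (a - b) ≤ ‖a - b‖ ^ 2 := by
  rw [inner_eq_trace, norm_sq_eq_trace, map_sub, map_sub, reaction, reaction,
    LinearEquiv.apply_symm_apply, LinearEquiv.apply_symm_apply]
  have h := trace_cubic_monotone (toMat a) (toMat b)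
  set A := toMat a
  set B := toMat b
  have e : A - A * Aᵀ * A - (B - B * Bᵀ * B) = (A - B) - (A * Aᵀ * A - B * Bᵀ * B) := by abel
  rw [e, Matrix.sub_mul, Matrix.trace_sub]
  linarith

lemma nonlinFlow_zero (a : MSp m) : nonlinFlow 0 a = a := by
  simp [nonlinFlow, nonlinProp_zero]

lemma norm_nonlinFlow_le {t : ℝ} (ht : 0 ≤ t) (a : MSp m) :
    ‖nonlinFlow t a‖ ≤ Real.exp t * ‖a‖ := by
  refine le_of_sq_le_sq ?_ (by positivity)
  rw [mul_pow, norm_sq_eq_trace, norm_sq_eq_trace, nonlinFlow, LinearEquiv.apply_symm_apply]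
  exact trace_nonlinProp_le ht _

attribute [local instance] Matrix.linftyOpNormedRing Matrix.linftyOpNormedAlgebra

/-- `toMat` as a continuous linear equivalence. -/
def toMatL : MSp m ≃L[ℝ] Mat m := toMat.toContinuousLinearEquiv

lemma contDiff_reaction {n : WithTop ℕ∞} : ContDiff ℝ n (reaction (m := m)) := by
  have h1 : ContDiff ℝ n (fun a : MSp m => toMat a) := (toMatL (m := m)).contDiff
  have h2 : ContDiff ℝ n (fun a : MSp m => (toMat a)ᵀ) := contDiff_transpose_mat.comp h1
  exact (toMatL (m := m)).symm.contDiff.comp (h1.sub ((h1.mul h2).mul h1))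

lemma contDiffAt_nonlinFlow {t : ℝ} (ht : 0 ≤ t) (a : MSp m) :
    ContDiffAt ℝ (⊤ : ℕ∞) (fun p : ℝ × MSp m => nonlinFlow p.1 p.2) (t, a) := by
  have h1 : ContDiffAt ℝ (⊤ : ℕ∞) (fun p : ℝ × MSp m => (p.1, toMat p.2)) (t, a) :=
    (contDiff_fst.prodMk ((toMatL (m := m)).contDiff.comp contDiff_snd)).contDiffAt
  have h2 : ContDiffAt ℝ (⊤ : ℕ∞) (fun p : ℝ × MSp m => nonlinProp p.1 (toMat p.2)) (t, a) :=
    ContDiffAt.comp (t, a) (g := fun p : ℝ × Mat m => nonlinProp p.1 p.2)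
      (f := fun p : ℝ × MSp m => (p.1, toMat p.2)) (contDiffAt_nonlinProp ht (toMat a)) h1
  exact (toMatL (m := m)).symm.contDiff.contDiffAt.comp (t, a) h2

lemma hasDerivAt_nonlinFlow {t : ℝ} (ht : 0 ≤ t) (a : MSp m) :
    HasDerivAt (fun s => nonlinFlow s a) (reaction (nonlinFlow t a)) t := by
  have h := (toMatL (m := m)).symm.hasFDerivAt.comp_hasDerivAt t
    (hasDerivAt_nonlinProp ht (toMat a))
  exact h

end Euclidean

/-! ### Derivatives along vector fields and uniform estimates on balls. -/

section SmoothMaps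

variable {F G : Type*} [NormedAddCommGroup F] [NormedSpace ℝ F]
  [NormedAddCommGroup G] [NormedSpace ℝ G]

/-- The derivative of `g` along the vector field `f`. -/
def lieDeriv (f : F → F) (g : F → G) (a : F) : G := fderiv ℝ g a (f a)

lemma contDiff_lieDeriv {f : F → F} {g : F → G} (hf : ContDiff ℝ (⊤ : ℕ∞) f)
    (hg : ContDiff ℝ (⊤ : ℕ∞) g) : ContDiff ℝ (⊤ : ℕ∞) (lieDeriv f g) :=
  (hg.fderiv_right (m := (⊤ : ℕ∞)) (by simp)).clm_apply hf

lemma top_ne_zero_withTop : ((⊤ : ℕ∞) : WithTop ℕ∞) ≠ 0 := by simp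

lemma hasDerivAt_comp_lieDeriv {f : F → F} {g : F → G} (hg : ContDiff ℝ (⊤ : ℕ∞) g)
    {φ : ℝ → F} {t : ℝ} (hφ : HasDerivAt φ (f (φ t)) t) :
    HasDerivAt (fun s => g (φ s)) (lieDeriv f g (φ t)) t :=
  (hg.differentiable top_ne_zero_withTop (φ t)).hasFDerivAt.comp_hasDerivAt t hφ

lemma exists_bound_of_contDiff [FiniteDimensional ℝ F] {n : WithTop ℕ∞} {g : F → G}
    (hg : ContDiff ℝ n g) (R : ℝ) : ∃ C, 0 ≤ C ∧ ∀ a, ‖a‖ ≤ R → ‖g a‖ ≤ C := by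
  have : ProperSpace F := FiniteDimensional.proper ℝ F
  obtain ⟨C, hC⟩ := (isCompact_closedBall (0 : F) R).exists_bound_of_continuousOn
    hg.continuous.continuousOn
  exact ⟨max C 0, le_max_right _ _,
    fun a ha => (hC a (by simpa using ha)).trans (le_max_left _ _)⟩

lemma exists_lipschitz_of_contDiff [FiniteDimensional ℝ F] {g : F → G}
    (hg : ContDiff ℝ (⊤ : ℕ∞) g) (R : ℝ) :
    ∃ K, 0 ≤ K ∧ ∀ a b, ‖a‖ ≤ R → ‖b‖ ≤ R → ‖g a - g b‖ ≤ K * ‖a - b‖ := by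
  obtain ⟨K, hK0, hK⟩ := exists_bound_of_contDiff
    (hg.fderiv_right (m := (⊤ : ℕ∞)) (by simp)) R
  refine ⟨K, hK0, fun a b ha hb => ?_⟩
  exact (convex_closedBall (0 : F) R).norm_image_sub_le_of_norm_fderiv_le
    (fun c _ => hg.differentiable top_ne_zero_withTop c)
    (fun c hc => hK c (by simpa using hc)) (by simpa using hb) (by simpa using ha)

/-- The scalar variable is time and `c` collects the parameters, so that one constant serves all
parameter values in a ball. The second derivative is the iterated Lie derivative along the constant
field $(1,0)$. -/
lemma exists_taylor_two_of_contDiff [FiniteDimensional ℝ F] {q : ℝ × F → G}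
    (hq : ContDiff ℝ (⊤ : ℕ∞) q) (R H : ℝ) :
    ∃ C, 0 ≤ C ∧ ∀ c, ‖c‖ ≤ R → ∀ t, 0 ≤ t → t ≤ H →
      ‖q (t, c) - q (0, c) - t • fderiv ℝ q (0, c) (1, 0)‖ ≤ C * t ^ 2 := by
  set e : ℝ × F → ℝ × F := fun _ => (1, 0)
  have he : ContDiff ℝ (⊤ : ℕ∞) e := contDiff_const
  have h1 := contDiff_lieDeriv he hq
  obtain ⟨C, hC0, hC⟩ := exists_bound_of_contDiff (contDiff_lieDeriv he h1) (max R H)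
  have hline : ∀ (c : F) (t : ℝ), HasDerivAt (fun s : ℝ => (s, c)) (e (t, c)) t := fun c t =>
    (hasDerivAt_id t).prodMk (hasDerivAt_const t c)
  refine ⟨C, hC0, fun c hc t ht htH => ?_⟩
  exact norm_taylor_two_le (φ := fun t => q (t, c)) (φ₁ := fun t => lieDeriv e q (t, c))
    (hq.continuous.comp (Continuous.prodMk_left c)).continuousOn
    (h1.continuous.comp (Continuous.prodMk_left c)).continuousOn
    (fun t _ _ => hasDerivAt_comp_lieDeriv hq (hline c t))
    (fun t _ _ => hasDerivAt_comp_lieDeriv h1 (hline c t))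
    (fun t ht htH => hC _ (by
      rw [Prod.norm_def]
      refine max_le ?_ (hc.trans (le_max_left _ _))
      rw [Real.norm_of_nonneg ht.le]; exact htH.trans (le_max_right _ _))) ht htH

/-- After translation by $(t,0)$ the slice is composition with the linear inclusion `inr`. Since
smoothness is known only near the point, the computation runs through an open set on which it holds.
-/
lemma iteratedFDeriv_comp_prodMk {f : ℝ × F → G} {n : ℕ} {t : ℝ} {a : F}
    (hf : ContDiffAt ℝ n f (t, a)) {i : ℕ} (hi : i ≤ n) :
    iteratedFDeriv ℝ i (fun b => f (t, b)) a
      = (iteratedFDeriv ℝ i f (t, a)).compContinuousLinearMap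
          (fun _ => ContinuousLinearMap.inr ℝ ℝ F) := by
  have hev := hf.eventually (by simp)
  obtain ⟨u, hu, huo, hau⟩ := eventually_nhds_iff.1 hev
  set s : Set (ℝ × F) := (fun p => p + (t, 0)) ⁻¹' u
  have hso : IsOpen s := huo.preimage (by fun_prop)
  have hf' : ContDiffOn ℝ n (fun p => f (p + (t, 0))) s := by
    intro p hp
    have h1 : ContDiffAt ℝ n f (p + (t, 0)) := hu _ hp
    exact (h1.comp p (f := fun p : ℝ × F => p + (t, 0))
      (ContDiff.contDiffAt (by fun_prop))).contDiffWithinAt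
  have hpre : IsOpen ((ContinuousLinearMap.inr ℝ ℝ F) ⁻¹' s) :=
    hso.preimage (ContinuousLinearMap.inr ℝ ℝ F).continuous
  have ha : (ContinuousLinearMap.inr ℝ ℝ F) a ∈ s := by
    change (0, a) + (t, 0) ∈ u
    simpa using hau
  have key := (ContinuousLinearMap.inr ℝ ℝ F).iteratedFDerivWithin_comp_right hf'
    hso.uniqueDiffOn hpre.uniqueDiffOn ha (i := i) (by exact_mod_cast hi)
  rw [iteratedFDerivWithin_of_isOpen i hpre ha, iteratedFDerivWithin_of_isOpen i hso ha,
    iteratedFDeriv_comp_add_right] at key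
  simpa [Function.comp_def] using key

end SmoothMaps

/-! ### The nonlinear flow as a perturbation of the identity. -/

section NonlinFlow

variable {m : ℕ}

/-- Time derivatives of the flow are iterated Lie derivatives of the reaction, evaluated in the ball
of radius $e^HR$ where the flow stays. -/
lemma nonlinFlow_taylor_three (R H : ℝ) :
    ∃ C, 0 ≤ C ∧ ∀ a : MSp m, ‖a‖ ≤ R → ∀ t, 0 ≤ t → t ≤ H →
      ‖nonlinFlow t a - a - t • reaction a - (t ^ 2 / 2) • lieDeriv reaction reaction a‖
        ≤ C * t ^ 3 := by
  have h1 : ContDiff ℝ (⊤ : ℕ∞) (reaction (m := m)) := contDiff_reaction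
  have h2 := contDiff_lieDeriv h1 h1
  obtain ⟨C, hC0, hC⟩ := exists_bound_of_contDiff (contDiff_lieDeriv h1 h2) (Real.exp H * R)
  refine ⟨C, hC0, fun a ha t ht htH => ?_⟩
  have hd : ∀ t : ℝ, 0 ≤ t → HasDerivAt (fun s => nonlinFlow s a) (reaction (nonlinFlow t a)) t :=
    fun t ht => hasDerivAt_nonlinFlow ht a
  have key := norm_taylor_three_le (φ := fun t => nonlinFlow t a)
    (φ₁ := fun t => reaction (nonlinFlow t a))
    (φ₂ := fun t => lieDeriv reaction reaction (nonlinFlow t a)) (H := H) (B := C)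
    (fun t ht => (hd t ht.1).continuousAt.continuousWithinAt)
    (fun t ht => (hasDerivAt_comp_lieDeriv h1 (hd t ht.1)).continuousAt.continuousWithinAt)
    (fun t ht => (hasDerivAt_comp_lieDeriv h2 (hd t ht.1)).continuousAt.continuousWithinAt)
    (fun t ht _ => hd t ht.le)
    (fun t ht _ => hasDerivAt_comp_lieDeriv h1 (hd t ht.le))
    (fun t ht _ => hasDerivAt_comp_lieDeriv h2 (hd t ht.le))
    (fun t ht htH => hC _ ((norm_nonlinFlow_le ht.le a).trans (by gcongr))) ht htH
  simpa only [nonlinFlow_zero] using key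

lemma contDiff_nonlinFlow {t : ℝ} (ht : 0 ≤ t) :
    ContDiff ℝ (⊤ : ℕ∞) (nonlinFlow (m := m) t) := by
  rw [contDiff_iff_contDiffAt]
  intro a
  exact ContDiffAt.comp a (g := fun p : ℝ × MSp m => nonlinFlow p.1 p.2)
    (f := fun b => (t, b)) (contDiffAt_nonlinFlow ht a) (by fun_prop)

/-- The flow is the identity at $t=0$, and the time derivative of its space derivatives is bounded
on the compact set $[0,H]\times\overline B_R$. -/
lemma exists_bound_iteratedFDeriv_nonlinFlow_sub (k : ℕ) (R H : ℝ) :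
    ∃ C, 0 ≤ C ∧ ∀ t, 0 ≤ t → t ≤ H → ∀ i ≤ k, ∀ a : MSp m, ‖a‖ ≤ R →
      ‖iteratedFDeriv ℝ i (fun b => nonlinFlow t b - b) a‖ ≤ C * t := by
  have hle : ∀ i : ℕ, (i : WithTop ℕ∞) ≤ ((⊤ : ℕ∞) : WithTop ℕ∞) := fun i => by
    exact_mod_cast le_top
  have hone : ∀ i : ℕ, ∃ C, 0 ≤ C ∧ ∀ t, 0 ≤ t → t ≤ H → ∀ a : MSp m, ‖a‖ ≤ R →
      ‖iteratedFDeriv ℝ i (fun b => nonlinFlow t b - b) a‖ ≤ C * t := by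
    intro i
    set N : ℝ × MSp m → MSp m := fun p => nonlinFlow p.1 p.2
    set W : ℝ × MSp m → _ := iteratedFDeriv ℝ i N
    have hW : ∀ t, 0 ≤ t → ∀ a, ContDiffAt ℝ (⊤ : ℕ∞) W (t, a) := fun t ht a =>
      (contDiffAt_nonlinFlow ht a).iteratedFDeriv_right (by
        exact_mod_cast (top_add (i : ℕ∞)).le)
    have hcomp : IsCompact (Icc (0 : ℝ) H ×ˢ Metric.closedBall (0 : MSp m) R) :=
      isCompact_Icc.prod (isCompact_closedBall 0 R)
    obtain ⟨C, hC⟩ := hcomp.exists_bound_of_continuousOn (f := fun p => fderiv ℝ W p)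
      (fun p hp => ((hW p.1 hp.1.1 p.2).fderiv_right (m := 0) (by simp)).continuousAt
        |>.continuousWithinAt)
    refine ⟨max C 0, le_max_right _ _, fun t ht htH a ha => ?_⟩
    let J : ContinuousMultilinearMap ℝ (fun _ : Fin i => ℝ × MSp m) (MSp m) →L[ℝ]
        ContinuousMultilinearMap ℝ (fun _ : Fin i => MSp m) (MSp m) :=
      ContinuousMultilinearMap.compContinuousLinearMapL
        (fun _ : Fin i => ContinuousLinearMap.inr ℝ ℝ (MSp m))
    have hJ : ‖J‖ ≤ 1 := by
      refine (ContinuousMultilinearMap.norm_compContinuousLinearMapL_le _ _).trans ?_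
      exact Finset.prod_le_one (fun _ _ => norm_nonneg _)
        (fun _ _ => ContinuousLinearMap.norm_inr_le_one ℝ ℝ (MSp m))
    have hslice : ∀ t, 0 ≤ t → iteratedFDeriv ℝ i (fun b => nonlinFlow t b) a = J (W (t, a)) :=
      fun t ht => iteratedFDeriv_comp_prodMk (f := N) (n := i)
        ((contDiffAt_nonlinFlow ht a).of_le (hle i)) le_rfl
    have hd : ∀ t, 0 ≤ t → HasDerivAt (fun s => J (W (s, a))) (J (fderiv ℝ W (t, a) (1, 0))) t := by
      intro t ht
      have h1 := ((hW t ht a).differentiableAt top_ne_zero_withTop).hasFDerivAt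
      have h2 : HasDerivAt (fun s : ℝ => (s, a)) (1, 0) t :=
        (hasDerivAt_id t).prodMk (hasDerivAt_const t a)
      exact J.hasFDerivAt.comp_hasDerivAt t (h1.comp_hasDerivAt t h2)
    have key := norm_sub_le_of_hasDerivAt (φ := fun s => J (W (s, a))) (H := H) (B := max C 0)
      (fun t ht => (hd t ht.1).continuousAt.continuousWithinAt)
      (fun t ht _ => hd t ht.le)
      (fun t ht htH => by
        have h1 : ‖fderiv ℝ W (t, a)‖ ≤ max C 0 :=
          (hC (t, a) ⟨⟨ht.le, htH⟩, by simpa using ha⟩).trans (le_max_left _ _)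
        have h2 : ‖((1 : ℝ), (0 : MSp m))‖ = 1 := by simp [Prod.norm_def]
        calc ‖J (fderiv ℝ W (t, a) (1, 0))‖ ≤ ‖J‖ * ‖fderiv ℝ W (t, a) (1, 0)‖ := J.le_opNorm _
          _ ≤ 1 * (‖fderiv ℝ W (t, a)‖ * ‖((1 : ℝ), (0 : MSp m))‖) := by
              gcongr; exact ContinuousLinearMap.le_opNorm _ _
          _ ≤ max C 0 := by rw [h2, one_mul, mul_one]; exact h1) ht htH
    have hsub : iteratedFDeriv ℝ i (fun b => nonlinFlow t b - b) a
        = iteratedFDeriv ℝ i (fun b => nonlinFlow t b) a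
          - iteratedFDeriv ℝ i (fun b : MSp m => b) a :=
      iteratedFDeriv_sub_apply (((contDiff_nonlinFlow ht).of_le (hle i)).contDiffAt)
        contDiff_id.contDiffAt
    have hid : (fun b : MSp m => b) = fun b => nonlinFlow 0 b := by
      funext b; exact (nonlinFlow_zero b).symm
    rw [hsub, hslice t ht, hid, hslice 0 le_rfl]
    exact key
  choose C hC0 hC using hone
  refine ⟨∑ i ∈ Finset.range (k + 1), C i, Finset.sum_nonneg fun i _ => hC0 i,
    fun t ht htH i hi a ha => (hC i t ht htH a ha).trans ?_⟩
  gcongr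
  exact Finset.single_le_sum (f := C) (fun i _ => hC0 i) (Finset.mem_range.2 (by omega))

/-- Composition with the nonlinear flow expands the scale of the derivatives by at most a
factor `1 + O(t)`. -/
lemma exists_iteratedFDeriv_nonlinFlow_comp_le {d : ℕ} (k : ℕ) (R H : ℝ) :
    ∃ C, 0 ≤ C ∧ ∀ t, 0 ≤ t → t ≤ H → ∀ (V : Sp d → MSp m) (D : ℝ), 0 ≤ D → ContDiff ℝ k V →
      (∀ x, ‖V x‖ ≤ R) → (∀ i, 1 ≤ i → i ≤ k → ∀ x, ‖iteratedFDeriv ℝ i V x‖ ≤ D ^ i) →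
      ∀ i, 1 ≤ i → i ≤ k → ∀ x,
        ‖iteratedFDeriv ℝ i (fun y => nonlinFlow t (V y)) x‖ ≤ ((1 + C * t) * D) ^ i := by
  obtain ⟨C, hC0, hC⟩ := exists_bound_iteratedFDeriv_nonlinFlow_sub (m := m) k R H
  refine ⟨k.factorial * C, by positivity, fun t ht htH V D hD hV hR hVD i hi hik x => ?_⟩
  have hle : (k : WithTop ℕ∞) ≤ ((⊤ : ℕ∞) : WithTop ℕ∞) := by exact_mod_cast le_top
  have hik' : (i : WithTop ℕ∞) ≤ k := by exact_mod_cast hik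
  set g : MSp m → MSp m := fun b => nonlinFlow t b - b
  have hg : ContDiff ℝ k g := ((contDiff_nonlinFlow ht).of_le hle).sub contDiff_id
  -- Only the correction $g$ is composed: it contributes at most $i!\,Ct\,D^i$, in addition to the
  -- $D^i$ from $V$ itself. The common scale $D$ for all orders is what lets the estimate be
  -- iterated.
  have h1 := norm_iteratedFDeriv_comp_le (n := i) hg hV hik' x (C := C * t) (D := D)
    (fun j hj => hC t ht htH j (hj.trans hik) _ (hR x))
    (fun j hj hj' => hVD j hj (hj'.trans hik) x)
  have h2 : iteratedFDeriv ℝ i (fun y => nonlinFlow t (V y)) x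
      = iteratedFDeriv ℝ i V x + iteratedFDeriv ℝ i (g ∘ V) x := by
    rw [← iteratedFDeriv_add_apply (hV.contDiffAt.of_le hik')
      ((hg.comp hV).contDiffAt.of_le hik')]
    congr 1
    funext y
    simp [g]
  have h3 : (i.factorial : ℝ) ≤ k.factorial := by exact_mod_cast Nat.factorial_le hik
  have h4 : 0 ≤ k.factorial * C * t := by positivity
  rw [h2, mul_pow]
  calc ‖iteratedFDeriv ℝ i V x + iteratedFDeriv ℝ i (g ∘ V) x‖
      ≤ D ^ i + i.factorial * (C * t) * D ^ i :=
        (norm_add_le _ _).trans (add_le_add (hVD i hi hik x) h1)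
    _ ≤ D ^ i + k.factorial * (C * t) * D ^ i := by gcongr
    _ = (1 + k.factorial * C * t) * D ^ i := by ring
    _ ≤ (1 + k.factorial * C * t) ^ i * D ^ i := by
        gcongr
        exact le_self_pow₀ (by linarith) (by omega)

end NonlinFlow

/-! ### Uniform $C^k$ bounds on the numerical solution. -/

section Regularity

variable {d m : ℕ}

/-- One Strang step for functions with values in the Euclidean space of matrices; `κ` is half the
diffusion coefficient. -/
def splitStep (κ t : ℝ) (V : Sp d → MSp m) : Sp d → MSp m :=
  heatOp (κ * t) (fun x => nonlinFlow t (heatOp (κ * t) V x))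

/-- The numerical solutions are bounded in `C^k`, uniformly in the step size. -/
lemma exists_bddC_splitStep_iterate (k : ℕ) (κ T B : ℝ) :
    ∃ B', ∀ V : Sp d → MSp m, BddC k B V → ∀ t, 0 < t → ∀ n : ℕ, n * t ≤ T →
      BddC k B' ((splitStep κ t)^[n] V) := by
  set B₀ := max B 1
  have hB₀ : 1 ≤ B₀ := le_max_right _ _
  obtain ⟨C, hC0, hC⟩ := exists_iteratedFDeriv_nonlinFlow_comp_le (d := d) (m := m) k
    (Real.exp T * B₀) T
  have hle : (k : WithTop ℕ∞) ≤ ((⊤ : ℕ∞) : WithTop ℕ∞) := by exact_mod_cast le_top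
  refine ⟨max (Real.exp T * B₀) ((Real.exp (C * T) * B₀) ^ k), fun V hV t ht n => ?_⟩
  -- Sup norm and derivatives are tracked separately. The former grows by $e^t$ per step and so
  -- stays in the fixed ball for which $C$ was chosen; the latter have scale multiplied by $1+Ct$.
  have main : n * t ≤ T → ContDiff ℝ k ((splitStep κ t)^[n] V) ∧
      (∀ x, ‖(splitStep κ t)^[n] V x‖ ≤ Real.exp (n * t) * B₀) ∧
      ∀ i, 1 ≤ i → i ≤ k → ∀ x,
        ‖iteratedFDeriv ℝ i ((splitStep κ t)^[n] V) x‖ ≤ ((1 + C * t) ^ n * B₀) ^ i := by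
    induction n with
    | zero =>
      intro _
      refine ⟨hV.1, fun x => ?_, fun i hi hik x => ?_⟩
      · rw [Function.iterate_zero, id, Nat.cast_zero, zero_mul, Real.exp_zero, one_mul]
        exact (hV.norm_le x).trans (le_max_left B 1)
      · rw [pow_zero, one_mul]
        exact (hV.2 i hik x).trans ((le_max_left B 1).trans (le_self_pow₀ hB₀ (by omega)))
    | succ n ih =>
      intro hn
      push_cast at hn
      have hnt : 0 ≤ n * t := by positivity
      obtain ⟨h1, h2, h3⟩ := ih (by linarith)
      rw [Function.iterate_succ_apply']
      set W := (splitStep κ t)^[n] V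
      have htT : t ≤ T := by linarith
      have hW : ∀ i ≤ k, ∀ x, ‖iteratedFDeriv ℝ i W x‖
          ≤ if i = 0 then Real.exp (n * t) * B₀ else ((1 + C * t) ^ n * B₀) ^ i := by
        intro i hi x
        split_ifs with h
        · subst h; rw [norm_iteratedFDeriv_zero]; exact h2 x
        · exact h3 i (by omega) hi x
      obtain ⟨a1, a2⟩ := contDiff_heatOp (κ * t) k h1 hW
      have a0 : ∀ x, ‖heatOp (κ * t) W x‖ ≤ Real.exp (n * t) * B₀ := norm_heatOp_le h2 _
      have b1 : ContDiff ℝ k (fun x => nonlinFlow t (heatOp (κ * t) W x)) :=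
        ((contDiff_nonlinFlow ht.le).of_le hle).comp a1
      have b0 : ∀ x, ‖nonlinFlow t (heatOp (κ * t) W x)‖ ≤ Real.exp ((n + 1) * t) * B₀ := by
        intro x
        refine (norm_nonlinFlow_le ht.le _).trans ?_
        rw [add_mul, one_mul, add_comm, Real.exp_add, mul_assoc]
        exact mul_le_mul_of_nonneg_left (a0 x) (Real.exp_pos _).le
      have b2 := hC t ht.le htT (heatOp (κ * t) W) ((1 + C * t) ^ n * B₀) (by positivity) a1
        (fun x => (a0 x).trans (by gcongr; linarith)) (fun i hi hik x => by
          have := a2 i hik x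
          rwa [if_neg (by omega)] at this)
      obtain ⟨c1, c2⟩ := contDiff_heatOp (κ * t) k b1
        (B := fun i => if i = 0 then Real.exp ((n + 1) * t) * B₀
          else ((1 + C * t) * ((1 + C * t) ^ n * B₀)) ^ i) (fun i hi x => by
          split_ifs with h
          · subst h; rw [norm_iteratedFDeriv_zero]; exact b0 x
          · exact b2 i (by omega) hi x)
      refine ⟨c1, fun x => ?_, fun i hi hik x => ?_⟩
      · push_cast
        exact norm_heatOp_le b0 _ _
      · have := c2 i hik x
        rw [if_neg (by omega)] at this
        rwa [pow_succ', mul_assoc]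
  intro hn
  obtain ⟨h1, h2, h3⟩ := main hn
  refine ⟨h1, fun i hi x => ?_⟩
  rcases Nat.eq_zero_or_pos i with rfl | hi0
  · rw [norm_iteratedFDeriv_zero]
    exact ((h2 x).trans (by gcongr)).trans (le_max_left _ _)
  · refine ((h3 i hi0 hi x).trans ?_).trans (le_max_right _ _)
    have e1 : (1 + C * t) ^ n ≤ Real.exp (C * T) := by
      calc (1 + C * t) ^ n ≤ Real.exp (C * t) ^ n := by
            gcongr; rw [add_comm]; exact Real.add_one_le_exp _
        _ = Real.exp (C * (n * t)) := by rw [← Real.exp_nat_mul]; congr 1; ring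
        _ ≤ Real.exp (C * T) := by gcongr
    have hT : 0 ≤ T := le_trans (by positivity) hn
    -- With a base at least one, the $k$-th power dominates all lower powers.
    have e2 : 1 ≤ Real.exp (C * T) * B₀ :=
      one_le_mul_of_one_le_of_one_le (Real.one_le_exp (by positivity)) hB₀
    calc ((1 + C * t) ^ n * B₀) ^ i ≤ (Real.exp (C * T) * B₀) ^ i := by gcongr
      _ ≤ (Real.exp (C * T) * B₀) ^ k := pow_le_pow_right₀ e2 hi

end Regularity

/-! ### Linearity of the heat semigroup on bounded continuous functions. -/

section BoundedContinuous

variable {d : ℕ} {F : Type*} [NormedAddCommGroup F] [NormedSpace ℝ F]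

/-- Bounded continuous functions. -/
def BddCont (g : Sp d → F) : Prop := Continuous g ∧ ∃ B, ∀ x, ‖g x‖ ≤ B

lemma BddCont.add {g h : Sp d → F} (hg : BddCont g) (hh : BddCont h) :
    BddCont (fun x => g x + h x) := by
  obtain ⟨hg, B, hB⟩ := hg
  obtain ⟨hh, B', hB'⟩ := hh
  exact ⟨hg.add hh, B + B', fun x => (norm_add_le _ _).trans (add_le_add (hB x) (hB' x))⟩

lemma BddCont.smul {g : Sp d → F} (hg : BddCont g) (c : ℝ) : BddCont (fun x => c • g x) := by
  obtain ⟨hg, B, hB⟩ := hg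
  exact ⟨hg.const_smul c, |c| * B, fun x => by
    rw [norm_smul, Real.norm_eq_abs]
    exact mul_le_mul_of_nonneg_left (hB x) (abs_nonneg c)⟩

lemma UnifC.bddCont {ι : Type*} {k : ℕ} {v : ι → Sp d → F} (h : UnifC k v) (p : ι) :
    BddCont (v p) := by
  obtain ⟨B, -, hB⟩ := h.bound
  exact ⟨h.continuous p, B, hB p⟩

lemma BddCont.heatOp_add {g h : Sp d → F} (hg : BddCont g) (hh : BddCont h) (s : ℝ) (x : Sp d) :
    heatOp s (fun y => g y + h y) x = heatOp s g x + heatOp s h x := by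
  obtain ⟨hg, B, hB⟩ := hg
  obtain ⟨hh, B', hB'⟩ := hh
  exact MAC.heatOp_add hg hh hB hB' s x

lemma BddCont.heatOp_sub {g h : Sp d → F} (hg : BddCont g) (hh : BddCont h) (s : ℝ) (x : Sp d) :
    heatOp s (fun y => g y - h y) x = heatOp s g x - heatOp s h x := by
  have e : (fun y => g y - h y) = fun y => g y + (-1 : ℝ) • h y := by
    funext y; module
  rw [e, hg.heatOp_add (hh.smul _), heatOp_smul]
  module

end BoundedContinuous

/-! ### Residual of the Taylor polynomial and local error of one step. -/

section LocalError

variable {d m : ℕ} {ι : Type*}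

/-- The first time derivative of the solution, in terms of the solution. -/
def timeDeriv₁ (κ : ℝ) (V : Sp d → MSp m) (x : Sp d) : MSp m := κ • lap V x + reaction (V x)

/-- The second time derivative of the solution, in terms of the solution. -/
def timeDeriv₂ (κ : ℝ) (V : Sp d → MSp m) (x : Sp d) : MSp m :=
  κ • lap (timeDeriv₁ κ V) x + fderiv ℝ reaction (V x) (timeDeriv₁ κ V x)

/-- The second order Taylor polynomial in time of the solution starting from `V`. -/
def taylorSol (κ : ℝ) (V : Sp d → MSp m) (t : ℝ) (x : Sp d) : MSp m :=
  V x + t • timeDeriv₁ κ V x + (t ^ 2 / 2) • timeDeriv₂ κ V x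

lemma contDiff_fderiv_reaction_apply :
    ContDiff ℝ (⊤ : ℕ∞) (fun q : MSp m × MSp m => fderiv ℝ reaction q.1 q.2) := by
  have h : ContDiff ℝ (⊤ : ℕ∞) (fderiv ℝ (reaction (m := m))) :=
    (contDiff_reaction (n := (⊤ : ℕ∞))).fderiv_right (by simp)
  exact (h.comp contDiff_fst).clm_apply contDiff_snd

lemma natCast_le_top (k : ℕ) : (k : WithTop ℕ∞) ≤ ((⊤ : ℕ∞) : WithTop ℕ∞) := by
  exact_mod_cast le_top

lemma UnifC.fderiv_reaction {k : ℕ} {v w : ι → Sp d → MSp m} (hv : UnifC k v) (hw : UnifC k w) :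
    UnifC k (fun p x => _root_.fderiv ℝ reaction (v p x) (w p x)) :=
  (hv.prodMk hw).comp_contDiff (contDiff_fderiv_reaction_apply.of_le (natCast_le_top k))

lemma UnifC.timeDeriv₁ {k : ℕ} {v : ι → Sp d → MSp m} (hv : UnifC (k + 2) v) (κ : ℝ) :
    UnifC k (fun p => timeDeriv₁ κ (v p)) :=
  ((UnifC.lap hv).const_smul κ).add ((hv.mono (by omega)).comp_contDiff contDiff_reaction)

lemma UnifC.timeDeriv₂ {k : ℕ} {v : ι → Sp d → MSp m} (hv : UnifC (k + 4) v) (κ : ℝ) :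
    UnifC k (fun p => timeDeriv₂ κ (v p)) := by
  have h1 := UnifC.timeDeriv₁ (k := k + 2) hv κ
  exact ((UnifC.lap h1).const_smul κ).add
    (UnifC.fderiv_reaction (hv.mono (by omega)) (h1.mono (by omega)))

/-- The terms of order $t^0$ and $t^1$ cancel by the choice of `timeDeriv₁` and `timeDeriv₂`. There
remain the second-order remainder of the reaction and $\kappa\frac{t^2}2\Delta$ applied to
`timeDeriv₂`, which uses all six derivatives. -/
lemma exists_residual_taylorSol_le {v : ι → Sp d → MSp m} (hv : UnifC 6 v) (κ H : ℝ) :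
    UnifO H 2 (fun p t x => timeDeriv₁ κ (v p) x + t • timeDeriv₂ κ (v p) x
      - κ • lap (taylorSol κ (v p) t) x - reaction (taylorSol κ (v p) t x)) := by
  have h1 := UnifC.timeDeriv₁ (k := 4) hv κ
  have h2 := UnifC.timeDeriv₂ (k := 2) hv κ
  have h3 := UnifC.lap (k := 0) h2
  set q : ℝ × MSp m × MSp m × MSp m → MSp m := fun z =>
    reaction (z.2.1 + z.1 • z.2.2.1 + (z.1 ^ 2 / 2) • z.2.2.2)
  have hr : ContDiff ℝ (⊤ : ℕ∞) (reaction (m := m)) := contDiff_reaction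
  have hq : ContDiff ℝ (⊤ : ℕ∞) q := hr.comp (by fun_prop)
  have hfam : UnifC 0 (fun p x => (v p x, timeDeriv₁ κ (v p) x, timeDeriv₂ κ (v p) x)) :=
    (hv.mono (by omega)).prodMk ((h1.mono (by omega)).prodMk (h2.mono (by omega)))
  obtain ⟨R, hR0, hR⟩ := hfam.bound
  obtain ⟨C, hC0, hC⟩ := exists_taylor_two_of_contDiff hq R H
  have hqd : ∀ a b c : MSp m, fderiv ℝ q (0, a, b, c) (1, 0) = fderiv ℝ reaction a b := by
    intro a b c
    have e1 : HasDerivAt (fun s : ℝ => (s, a, b, c)) ((1 : ℝ), (0 : MSp m × MSp m × MSp m)) 0 :=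
      (hasDerivAt_id 0).prodMk (hasDerivAt_const 0 _)
    have e2 : HasDerivAt (fun s : ℝ => q (s, a, b, c)) (fderiv ℝ q (0, a, b, c) (1, 0)) 0 :=
      (hq.differentiable top_ne_zero_withTop _).hasFDerivAt.comp_hasDerivAt 0 e1
    have e3 : HasDerivAt (fun s : ℝ => a + s • b + (s ^ 2 / 2) • c) b 0 := by
      have f1 : HasDerivAt (fun s : ℝ => s ^ 2 / 2) 0 0 := by
        simpa using (hasDerivAt_pow 2 (0 : ℝ)).div_const 2
      have := (((hasDerivAt_id (0 : ℝ)).smul_const b).const_add a).fun_add (f1.smul_const c)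
      simpa using this
    have e4 : HasFDerivAt reaction (fderiv ℝ reaction a)
        ((fun s : ℝ => a + s • b + (s ^ 2 / 2) • c) 0) := by
      simpa using (hr.differentiable top_ne_zero_withTop a).hasFDerivAt
    have e5 := e4.comp_hasDerivAt 0 e3
    exact e2.unique e5
  have hE : UnifO H 2 (fun p t x => reaction (taylorSol κ (v p) t x) - reaction (v p x)
      - t • fderiv ℝ reaction (v p x) (timeDeriv₁ κ (v p) x)) := by
    refine ⟨C, hC0, fun p t ht htH x => ?_⟩
    have := hC _ (hR p x) t ht htH
    rw [hqd] at this
    simpa [q, taylorSol] using this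
  have hL : UnifO H 2 (fun p t x => ((κ / 2) * t ^ 2) • lap (timeDeriv₂ κ (v p)) x) :=
    (h3.unifO H).smul_pow (κ / 2) 2
  have hlap : ∀ p t x, lap (taylorSol κ (v p) t) x = lap (v p) x
      + t • lap (timeDeriv₁ κ (v p)) x + (t ^ 2 / 2) • lap (timeDeriv₂ κ (v p)) x := by
    intro p t x
    have c0 : ContDiff ℝ 2 (v p) := (hv.mono (l := 2) (by omega)).contDiff p
    have c1 : ContDiff ℝ 2 (timeDeriv₁ κ (v p)) := (h1.mono (l := 2) (by omega)).contDiff p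
    have c2 : ContDiff ℝ 2 (timeDeriv₂ κ (v p)) := h2.contDiff p
    have e : taylorSol κ (v p) t = fun x => (v p x + t • timeDeriv₁ κ (v p) x)
        + (t ^ 2 / 2) • timeDeriv₂ κ (v p) x := rfl
    rw [e, lap_add (c0.add (c1.const_smul t)) (c2.const_smul _), lap_add c0 (c1.const_smul t),
      lap_const_smul _ c1, lap_const_smul _ c2]
  have hneg := (hE.add hL).smul_pow (-1) 0
  rw [zero_add] at hneg
  refine hneg.congr fun p t _ _ x => ?_
  rw [hlap]
  have d1 : timeDeriv₁ κ (v p) x = κ • lap (v p) x + reaction (v p x) := rfl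
  have d2 : timeDeriv₂ κ (v p) x = κ • lap (timeDeriv₁ κ (v p)) x
    + fderiv ℝ reaction (v p x) (timeDeriv₁ κ (v p) x) := rfl
  generalize fderiv ℝ reaction (v p x) (timeDeriv₁ κ (v p) x) = y at *
  generalize lap (timeDeriv₂ κ (v p)) x = z at *
  generalize reaction (taylorSol κ (v p) t x) = w at *
  rw [d2, d1]
  module

/-- Separates the pure diffusion, the two mixed and the pure reaction contributions, which are the
groups that appear in the expansion of the splitting step. -/
lemma timeDeriv₂_eq {V : Sp d → MSp m} (hV : ContDiff ℝ 4 V) (κ : ℝ) (x : Sp d) :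
    timeDeriv₂ κ V x = κ ^ 2 • lap (lap V) x + κ • lap (fun y => reaction (V y)) x
      + κ • fderiv ℝ reaction (V x) (lap V x) + lieDeriv reaction reaction (V x) := by
  have h1 : ContDiff ℝ 2 (lap V) := by
    have e : lap V = fun x => bilinTrace d (MSp m) (fderiv ℝ (fderiv ℝ V) x) := by
      funext x; exact lap_eq_bilinTrace V x
    rw [e]
    exact (bilinTrace d (MSp m)).contDiff.comp
      (contDiff_fderiv_of_succ (k := 2) (contDiff_fderiv_of_succ (k := 3) hV))
  have h2 : ContDiff ℝ 2 (fun y => reaction (V y)) :=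
    contDiff_reaction.comp (hV.of_le (by norm_num))
  have e : timeDeriv₁ κ V = fun y => κ • lap V y + reaction (V y) := rfl
  rw [timeDeriv₂, e, lap_add (h1.const_smul κ) h2, lap_const_smul κ h1, map_add, map_smul,
    lieDeriv]
  module

/-- The local error of the splitting method, relative to the Taylor polynomial of the solution. -/
theorem splitStep_sub_taylorSol {v : ι → Sp d → MSp m} (hv : UnifC 6 v) {κ : ℝ} (hκ : 0 < κ)
    {H : ℝ} (hH : 0 ≤ H) :
    UnifO H 3 (fun p t x => splitStep κ t (v p) x - taylorSol (2 * κ) (v p) t x) := by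
  have hr : ContDiff ℝ (⊤ : ℕ∞) (reaction (m := m)) := contDiff_reaction
  set g₂ : MSp m → MSp m := lieDeriv reaction reaction with hg₂def
  have hg₂ : ContDiff ℝ (⊤ : ℕ∞) g₂ := contDiff_lieDeriv hr hr
  have hL := UnifC.lap (k := 4) hv
  have hLL := UnifC.lap (k := 2) hL
  have hf : UnifC 6 (fun p x => reaction (v p x)) := hv.comp_contDiff contDiff_reaction
  have hLf := UnifC.lap (k := 4) hf
  have hd : UnifC 4 (fun p x => fderiv ℝ reaction (v p x) (lap (v p) x)) :=
    UnifC.fderiv_reaction (hv.mono (by omega)) hL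
  have hg : UnifC 6 (fun p x => g₂ (v p x)) := hv.comp_contDiff (hg₂.of_le (natCast_le_top 6))
  obtain ⟨B, hB0, hB⟩ := hv.bound
  have hTB : ∀ p t x, ‖heatOp (κ * t) (v p) x‖ ≤ B := fun p t => norm_heatOp_le (hB p) _
  -- expansion of the inner heat step
  have o1 := heatOp_taylor_three hv hκ H
  -- expansion of the nonlinear step
  have o2 : UnifO H 3 (fun p t x => nonlinFlow t (heatOp (κ * t) (v p) x) - heatOp (κ * t) (v p) x
      - t • reaction (heatOp (κ * t) (v p) x) - (t ^ 2 / 2) • g₂ (heatOp (κ * t) (v p) x)) := by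
    obtain ⟨C, hC0, hC⟩ := nonlinFlow_taylor_three (m := m) B H
    exact ⟨C, hC0, fun p t ht htH x => hC _ (hTB p t x) t ht htH⟩
  have o3 : UnifO H 2 (fun p t x => reaction (heatOp (κ * t) (v p) x) - reaction (v p x)
      - (t * κ) • fderiv ℝ reaction (v p x) (lap (v p) x)) := by
    obtain ⟨R, hR0, hR⟩ := (UnifC.prodMk (hv.mono (l := 4) (by omega)) hL).bound
    set q : ℝ × MSp m × MSp m → MSp m := fun z => reaction (z.2.1 + (z.1 * κ) • z.2.2)
    have hq : ContDiff ℝ (⊤ : ℕ∞) q := hr.comp (by fun_prop)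
    have hqd : ∀ a b : MSp m, fderiv ℝ q (0, a, b) (1, 0) = κ • fderiv ℝ reaction a b := by
      intro a b
      have e1 : HasDerivAt (fun s : ℝ => (s, a, b)) ((1 : ℝ), (0 : MSp m × MSp m)) 0 :=
        (hasDerivAt_id 0).prodMk (hasDerivAt_const 0 _)
      have e2 : HasDerivAt (fun s : ℝ => q (s, a, b)) (fderiv ℝ q (0, a, b) (1, 0)) 0 :=
        (hq.differentiable top_ne_zero_withTop _).hasFDerivAt.comp_hasDerivAt 0 e1
      have e3 : HasDerivAt (fun s : ℝ => a + (s * κ) • b) (κ • b) 0 := by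
        simpa using (((hasDerivAt_id (0 : ℝ)).mul_const κ).smul_const b).const_add a
      have e4 : HasFDerivAt reaction (fderiv ℝ reaction a)
          ((fun s : ℝ => a + (s * κ) • b) 0) := by
        simpa using (hr.differentiable top_ne_zero_withTop a).hasFDerivAt
      rw [← map_smul]
      have e5 := e4.comp_hasDerivAt 0 e3
      exact e2.unique e5
    obtain ⟨C, hC0, hC⟩ := exists_taylor_two_of_contDiff hq R H
    have u1 : UnifO H 2 (fun p t x => q (t, v p x, lap (v p) x) - reaction (v p x)
        - (t * κ) • fderiv ℝ reaction (v p x) (lap (v p) x)) := by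
      refine ⟨C, hC0, fun p t ht htH x => ?_⟩
      have := hC _ (hR p x) t ht htH
      rw [hqd, smul_smul] at this
      simpa [q] using this
    -- The ball must contain both the heat evolution and its first-order polynomial; the two differ
    -- by $O(t^2)$, so the Lipschitz bound preserves the order.
    obtain ⟨K, hK0, hK⟩ := exists_lipschitz_of_contDiff hr (max B (R + H * κ * R))
    have u2 : UnifO H 2 (fun p t x => reaction (heatOp (κ * t) (v p) x)
        - q (t, v p x, lap (v p) x)) := by
      refine (heatOp_taylor_two (hv.mono (l := 4) (by omega)) hκ H).of_norm_le hK0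
        fun p t ht htH x => ?_
      refine (hK _ (v p x + (t * κ) • lap (v p) x) ((hTB p t x).trans (le_max_left _ _)) ?_).trans
        (le_of_eq ?_)
      · refine le_trans ?_ (le_max_right _ _)
        have n1 : ‖v p x‖ ≤ R := (norm_fst_le _).trans (hR p x)
        have n2 : ‖lap (v p) x‖ ≤ R := (norm_snd_le _).trans (hR p x)
        refine (norm_add_le _ _).trans (add_le_add n1 ?_)
        rw [norm_smul, Real.norm_of_nonneg (by positivity)]
        gcongr
      · rw [sub_sub]
    refine (u2.add u1).congr fun p t _ _ x => ?_
    abel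
  have o4 : UnifO H 1 (fun p t x => g₂ (heatOp (κ * t) (v p) x) - g₂ (v p x)) := by
    obtain ⟨K, hK0, hK⟩ := exists_lipschitz_of_contDiff hg₂ B
    exact (heatOp_taylor_one (hv.mono (l := 2) (by omega)) hκ H).of_norm_le hK0
      fun p t _ _ x => hK _ _ (hTB p t x) (hB p x)
  -- the nonlinear step up to third order, in terms of the initial value
  set w' : ι → ℝ → Sp d → MSp m := fun p t x =>
    (((((v p x + (t * κ) • lap (v p) x) + (t ^ 2 / 2 * κ ^ 2) • lap (lap (v p)) x)
      + t • reaction (v p x)) + (t ^ 2 * κ) • fderiv ℝ reaction (v p x) (lap (v p) x))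
      + (t ^ 2 / 2) • g₂ (v p x)) with hw'
  have o5 : UnifO H 3 (fun p t x => nonlinFlow t (heatOp (κ * t) (v p) x) - w' p t x) := by
    refine (((o2.add o1).add (o3.smul_pow 1 1)).add (o4.smul_pow (1 / 2) 2)).congr
      fun p t _ _ x => ?_
    simp only [hw']
    module
  have hw'b : ∀ p t, BddCont (w' p t) := fun p t =>
    (((((hv.bddCont p).add ((hL.bddCont p).smul _)).add ((hLL.bddCont p).smul _)).add
      ((hf.bddCont p).smul _)).add ((hd.bddCont p).smul _)).add ((hg.bddCont p).smul _)
  have hwb : ∀ p t, 0 ≤ t → BddCont (fun x => nonlinFlow t (heatOp (κ * t) (v p) x)) := by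
    intro p t ht
    refine ⟨(contDiff_nonlinFlow ht).continuous.comp ((continuous_heatOp (hv.continuous p)
      (hB p)).comp (Continuous.prodMk_right (κ * t))), Real.exp t * B, fun x => ?_⟩
    exact (norm_nonlinFlow_le ht _).trans (by gcongr; exact hTB p t x)
  have o6 := o5.heatOp κ
  have hexp : ∀ p t x, heatOp (κ * t) (w' p t) x = heatOp (κ * t) (v p) x
      + (t * κ) • heatOp (κ * t) (lap (v p)) x
      + (t ^ 2 / 2 * κ ^ 2) • heatOp (κ * t) (lap (lap (v p))) x
      + t • heatOp (κ * t) (fun x => reaction (v p x)) x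
      + (t ^ 2 * κ) • heatOp (κ * t) (fun x => fderiv ℝ reaction (v p x) (lap (v p) x)) x
      + (t ^ 2 / 2) • heatOp (κ * t) (fun x => g₂ (v p x)) x := by
    intro p t x
    have b0 := hv.bddCont p
    have b1 := (hL.bddCont p).smul (t * κ)
    have b2 := (hLL.bddCont p).smul (t ^ 2 / 2 * κ ^ 2)
    have b3 := (hf.bddCont p).smul t
    have b4 := (hd.bddCont p).smul (t ^ 2 * κ)
    have b5 := (hg.bddCont p).smul (t ^ 2 / 2)
    simp only [hw']
    rw [((((b0.add b1).add b2).add b3).add b4).heatOp_add b5,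
      (((b0.add b1).add b2).add b3).heatOp_add b4, ((b0.add b1).add b2).heatOp_add b3,
      (b0.add b1).heatOp_add b2, b0.heatOp_add b1]
    simp only [heatOp_smul]
  -- expansion of the outer heat step
  have p1 := (heatOp_taylor_two hL hκ H).smul_pow κ 1
  have p2 := (heatOp_taylor_one hLL hκ H).smul_pow (κ ^ 2 / 2) 2
  have p3 := (heatOp_taylor_two (hf.mono (l := 4) (by omega)) hκ H).smul_pow 1 1
  have p4 := (heatOp_taylor_one (hd.mono (l := 2) (by omega)) hκ H).smul_pow κ 2
  have p5 := (heatOp_taylor_one (hg.mono (l := 2) (by omega)) hκ H).smul_pow (1 / 2) 2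
  -- A term carrying $t^j$ is expanded only up to order $3-j$. The second-order coefficients agree
  -- with diffusion $2\kappa$: $\frac{\kappa^2}2+\kappa^2+\frac{\kappa^2}2=\frac{(2\kappa)^2}2$ for
  -- $\Delta^2$, and $\kappa$ for each mixed term thanks to the symmetric arrangement.
  refine ((((((o6.add o1).add p1).add p2).add p3).add p4).add p5).congr fun p t ht _ x => ?_
  have c4 : ContDiff ℝ 4 (v p) := (hv.mono (l := 4) (by omega)).contDiff p
  rw [(hwb p t ht).heatOp_sub (hw'b p t), hexp]
  simp only [splitStep, taylorSol, timeDeriv₂_eq c4, timeDeriv₁, ← hg₂def]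
  module

end LocalError

/-! ### Translation between matrix fields and Euclidean-valued functions. -/

section Transfer

variable {d m : ℕ}

/-- Coordinate projections commute with the vector-valued integral. Half a time step with diffusion
$\varepsilon^2$ is a full one with coefficient $\varepsilon^2/2$. -/
lemma linProp_toMat {ε τ : ℝ} (hε : 0 < ε) (hτ : 0 < τ) {W : Sp d → MSp m} (hW : BddCont W) :
    linProp ε (τ / 2) (fun x => toMat (W x))
      = fun x => toMat (heatOp (ε ^ 2 / 2 * τ) W x) := by
  obtain ⟨hc, B, hB⟩ := hW
  funext x
  ext i j
  have hs : 0 < τ / 2 * ε ^ 2 := by positivity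
  have h1 : linProp ε (τ / 2) (fun x => toMat (W x)) x i j
      = heatOp (τ / 2 * ε ^ 2) (fun y => W y (i, j)) x :=
    heatSemigroup_eq_heatOp hs (fun y => W y (i, j)) x
  have h2 := (EuclideanSpace.proj (𝕜 := ℝ) (i, j) : MSp m →L[ℝ] ℝ).integral_comp_comm
    (integrable_heatOp hc hB (τ / 2 * ε ^ 2) x)
  rw [h1, toMat_apply, show ε ^ 2 / 2 * τ = τ / 2 * ε ^ 2 by ring]
  refine Eq.trans ?_ h2
  simp [heatOp]

lemma strangStep_toMat {ε τ : ℝ} (hε : 0 < ε) (hτ : 0 < τ) {W : Sp d → MSp m} (hW : BddCont W) :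
    strangStep ε τ (fun x => toMat (W x))
      = fun x => toMat (splitStep (ε ^ 2 / 2) τ W x) := by
  have hb : BddCont (fun x => nonlinFlow τ (heatOp (ε ^ 2 / 2 * τ) W x)) := by
    obtain ⟨hc, B, hB⟩ := hW
    refine ⟨(contDiff_nonlinFlow hτ.le).continuous.comp ((continuous_heatOp hc hB).comp
      (Continuous.prodMk_right _)), Real.exp τ * B, fun x => ?_⟩
    exact (norm_nonlinFlow_le hτ.le _).trans (by gcongr; exact norm_heatOp_le hB _ x)
  rw [strangStep, linProp_toMat hε hτ hW]
  exact linProp_toMat hε hτ hb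

lemma strang_toMat {ε τ : ℝ} (hε : 0 < ε) (hτ : 0 < τ) {V : Sp d → MSp m} {n : ℕ}
    (h : ∀ j < n, BddCont ((splitStep (ε ^ 2 / 2) τ)^[j] V)) :
    strang ε τ (fun x => toMat (V x)) n
      = fun x => toMat ((splitStep (ε ^ 2 / 2) τ)^[n] V x) := by
  induction n with
  | zero => rfl
  | succ n ih =>
    have ih' := ih fun j hj => h j (by omega)
    rw [strang] at ih'
    rw [strang, Function.iterate_succ_apply', ih', strangStep_toMat hε hτ (h n (by omega)),
      Function.iterate_succ_apply']

lemma PerFun.splitStep {V : Sp d → MSp m} (h : PerFun V) (κ t : ℝ) :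
    PerFun (splitStep κ t V) :=
  ((h.heatOp _).comp (nonlinFlow t)).heatOp _

lemma PerFun.splitStep_iterate {V : Sp d → MSp m} (h : PerFun V) (κ t : ℝ) (n : ℕ) :
    PerFun ((MAC.splitStep κ t)^[n] V) := by
  induction n with
  | zero => exact h
  | succ n ih => rw [Function.iterate_succ_apply']; exact ih.splitStep κ t

lemma PerFun.timeDeriv₁ {V : Sp d → MSp m} (h : PerFun V) (κ : ℝ) : PerFun (timeDeriv₁ κ V) :=
  PerFun.comp₂ (PerFun.lap h) h fun a b => κ • a + reaction b

lemma PerFun.timeDeriv₂ {V : Sp d → MSp m} (h : PerFun V) (κ : ℝ) : PerFun (timeDeriv₂ κ V) :=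
  PerFun.comp₂ (PerFun.lap (h.timeDeriv₁ κ)) (PerFun.comp₂ h (h.timeDeriv₁ κ)
    fun a b => _root_.fderiv ℝ reaction a b) fun a b => κ • a + b

lemma PerFun.taylorSol {V : Sp d → MSp m} (h : PerFun V) (κ t : ℝ) : PerFun (taylorSol κ V t) :=
  PerFun.comp₂ (PerFun.comp₂ h (h.timeDeriv₁ κ) fun a b => a + t • b) (h.timeDeriv₂ κ)
    fun a b => a + (t ^ 2 / 2) • b

lemma laplacian_eq_lap (g : Sp d → ℝ) : Laplacian.laplacian g = lap g := by
  rw [InnerProductSpace.laplacian_eq_iteratedFDeriv_orthonormalBasis g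
    (EuclideanSpace.basisFun (Fin d) ℝ)]
  funext x
  simp [lap, iteratedFDeriv_two_apply]

lemma contDiff_toMat_symm {n : WithTop ℕ∞} {V : Sp d → Mat m}
    (hV : ∀ i j, ContDiff ℝ n fun x => V x i j) : ContDiff ℝ n fun x => toMat.symm (V x) :=
  contDiff_euclidean.2 fun p => hV p.1 p.2

lemma IsSolution.hasDerivAt_toMat_symm {ε : ℝ} {U₀ : Sp d → Mat m} {U : ℝ → Sp d → Mat m}
    (hU : IsSolution ε U₀ U) {t : ℝ} (ht : 0 < t) (x : Sp d) :
    HasDerivAt (fun s => toMat.symm (U s x))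
      (ε ^ 2 • lap (fun y => toMat.symm (U t y)) x + reaction (toMat.symm (U t x))) t := by
  have hc := contDiff_toMat_symm (hU.contDiff t ht)
  have h : HasDerivAt (fun s (p : Fin m × Fin m) => U s x p.1 p.2)
      (fun p => (ε ^ 2 • lap (fun y => toMat.symm (U t y)) x
        + reaction (toMat.symm (U t x))) p) t := by
    refine hasDerivAt_pi.2 fun p => ?_
    refine (hU.equation t ht x p.1 p.2).congr_deriv ?_
    rw [laplacian_eq_lap]
    have h1 := lap_clm_comp (EuclideanSpace.proj (𝕜 := ℝ) p : MSp m →L[ℝ] ℝ) hc x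
    have h2 : lap (fun y => U t y p.1 p.2) x = (lap (fun y => toMat.symm (U t y)) x) p := h1
    rw [h2]
    simp [reaction]
  exact (EuclideanSpace.equiv (Fin m × Fin m) ℝ).symm.hasFDerivAt.comp_hasDerivAt t h

lemma IsSolution.continuousOn_toMat_symm {ε : ℝ} {U₀ : Sp d → Mat m} {U : ℝ → Sp d → Mat m}
    (hU : IsSolution ε U₀ U) :
    ContinuousOn (fun p : ℝ × Sp d => toMat.symm (U p.1 p.2)) (Ici 0 ×ˢ univ) :=
  (PiLp.continuous_toLp 2 _).comp_continuousOn
    (continuousOn_pi.2 fun p => hU.continuousOn p.1 p.2)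

end Transfer

/-! ### Error recursion and global convergence. -/

section GlobalError

variable {d m : ℕ}

/-- One step of the error recursion: the solution is compared with the Taylor polynomial started
at the numerical solution. -/
lemma norm_sub_splitStep_le {κ C₁ C₂ δ t₀ τ : ℝ} (hκ : 0 ≤ κ) (hC₁ : 0 ≤ C₁) (hδ : 0 ≤ δ)
    (ht₀ : 0 ≤ t₀) (hτ : 0 < τ) {u : ℝ → Sp d → MSp m} {V : Sp d → MSp m}
    (huc : ContinuousOn (fun p : ℝ × Sp d => u p.1 p.2) (Ici 0 ×ˢ univ))
    (hup : ∀ t, 0 ≤ t → PerFun (u t)) (hu2 : ∀ t, 0 < t → ContDiff ℝ 2 (u t))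
    (hud : ∀ t, 0 < t → ∀ x, HasDerivAt (fun s => u s x) (κ • lap (u t) x + reaction (u t x)) t)
    {B : ℝ} (hV : BddC 6 B V) (hVp : PerFun V)
    (hres : ∀ t, 0 ≤ t → t ≤ τ → ∀ x, ‖timeDeriv₁ κ V x + t • timeDeriv₂ κ V x
      - κ • lap (taylorSol κ V t) x - reaction (taylorSol κ V t x)‖ ≤ C₁ * t ^ 2)
    (hloc : ∀ x, ‖splitStep (κ / 2) τ V x - taylorSol κ V τ x‖ ≤ C₂ * τ ^ 3)
    (h0 : ∀ x, ‖u t₀ x - V x‖ ≤ δ) (x : Sp d) :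
    ‖u (t₀ + τ) x - splitStep (κ / 2) τ V x‖ ≤ Real.exp τ * (δ + C₁ * τ ^ 3) + C₂ * τ ^ 3 := by
  have hfam : UnifC 6 (fun _ : Unit => V) := ⟨B, fun _ => hV⟩
  have hA₁ := UnifC.timeDeriv₁ (k := 4) hfam κ
  have hA₂ := UnifC.timeDeriv₂ (k := 2) hfam κ
  have c0 := hfam.continuous ()
  have c1 := hA₁.continuous ()
  have c2 := hA₂.continuous ()
  have s0 : ContDiff ℝ 2 V := (hfam.mono (l := 2) (by omega)).contDiff ()
  have s1 : ContDiff ℝ 2 (timeDeriv₁ κ V) := (hA₁.mono (l := 2) (by omega)).contDiff ()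
  have s2 : ContDiff ℝ 2 (timeDeriv₂ κ V) := hA₂.contDiff ()
  have hmaps : ContinuousOn (fun p : ℝ × Sp d => u (t₀ + p.1) p.2) (Icc 0 τ ×ˢ univ) :=
    huc.comp (f := fun p : ℝ × Sp d => (t₀ + p.1, p.2)) (Continuous.continuousOn (by fun_prop))
      fun p hp => ⟨add_nonneg ht₀ hp.1.1, mem_univ _⟩
  -- The solution is restarted at $t_0$ while the polynomial starts at `V`, so the accumulated error
  -- enters as the initial distance and is amplified only by $e^\tau$.
  have hcmp := norm_sub_le_of_residual (f := reaction (m := m)) inner_reaction_sub_le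
    (κ := κ) (τ := τ) (δ := δ) (r := C₁ * τ ^ 2) hκ hδ (by positivity)
    (U := fun t => u (t₀ + t)) (P := taylorSol κ V)
    (P' := fun t x => timeDeriv₁ κ V x + t • timeDeriv₂ κ V x) hmaps
    (by
      unfold taylorSol
      exact Continuous.continuousOn (by fun_prop))
    (fun t ht _ => hup _ (by linarith)) (fun t _ _ => hVp.taylorSol κ t)
    (fun t ht _ => hu2 _ (by linarith))
    (fun t _ _ => (s0.add (s1.const_smul t)).add (s2.const_smul (t ^ 2 / 2)))
    (fun t ht _ x => (hud (t₀ + t) (by linarith) x).comp_const_add t₀ t)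
    (fun t _ _ x => by
      have f1 : HasDerivAt (fun s : ℝ => s ^ 2 / 2) t t := by
        simpa using (hasDerivAt_pow 2 t).div_const 2
      have := (((hasDerivAt_id t).smul_const (timeDeriv₁ κ V x)).const_add (V x)).fun_add
        (f1.smul_const (timeDeriv₂ κ V x))
      simpa [taylorSol] using this)
    (fun t ht htτ x => (hres t ht.le htτ x).trans (by gcongr))
    (fun x => by simpa [taylorSol] using h0 x) hτ.le le_rfl x
  calc ‖u (t₀ + τ) x - splitStep (κ / 2) τ V x‖
      = ‖(u (t₀ + τ) x - taylorSol κ V τ x)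
          - (splitStep (κ / 2) τ V x - taylorSol κ V τ x)‖ := by congr 1; abel
    _ ≤ Real.exp τ * (δ + C₁ * τ ^ 2 * τ) + C₂ * τ ^ 3 :=
        (norm_sub_le _ _).trans (add_le_add hcmp (hloc x))
    _ = _ := by ring

/-- Second order convergence of the splitting method in the supremum norm. -/
theorem exists_norm_sub_splitStep_iterate_le {κ : ℝ} (hκ : 0 < κ) {V : Sp d → MSp m}
    (hV : ContDiff ℝ 6 V) (hVp : PerFun V) {T : ℝ} (hT : 0 < T) :
    (∀ τ, 0 < τ → ∀ n : ℕ, n * τ ≤ T → BddCont ((splitStep (κ / 2) τ)^[n] V)) ∧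
    ∃ C, 0 ≤ C ∧ ∀ u : ℝ → Sp d → MSp m,
      ContinuousOn (fun p : ℝ × Sp d => u p.1 p.2) (Ici 0 ×ˢ univ) →
      (∀ t, 0 ≤ t → PerFun (u t)) → (∀ t, 0 < t → ContDiff ℝ 2 (u t)) →
      (∀ t, 0 < t → ∀ x,
        HasDerivAt (fun s => u s x) (κ • lap (u t) x + reaction (u t x)) t) →
      (∀ x, u 0 x = V x) → ∀ τ, 0 < τ → ∀ n : ℕ, n * τ ≤ T → ∀ x,
        ‖u (n * τ) x - (splitStep (κ / 2) τ)^[n] V x‖ ≤ C * τ ^ 2 := by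
  obtain ⟨B, hB⟩ := hVp.exists_bddC (k := 6) hV
  obtain ⟨B', hB'⟩ := exists_bddC_splitStep_iterate (d := d) (m := m) 6 (κ / 2) T B
  -- Indexing by all functions satisfying the $C^6$ bound fixes $C_1$ and $C_2$ before the step
  -- size, the step number and the solution are known.
  have hfam : UnifC 6 (fun W : {W : Sp d → MSp m // BddC 6 B' W} => W.1) := ⟨B', fun W => W.2⟩
  refine ⟨fun τ hτ n hn => hfam.bddCont ⟨_, hB' V hB τ hτ n hn⟩, ?_⟩
  obtain ⟨C₁, hC₁0, hC₁⟩ := exists_residual_taylorSol_le hfam κ T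
  obtain ⟨C₂, hC₂0, hC₂⟩ := splitStep_sub_taylorSol hfam (half_pos hκ) hT.le
  refine ⟨Real.exp T * (T * (C₁ + C₂)), by positivity,
    fun u huc hup hu2 hud hu0 τ hτ n hn => ?_⟩
  have main : n * τ ≤ T → ∀ x, ‖u (n * τ) x - (splitStep (κ / 2) τ)^[n] V x‖
      ≤ Real.exp (n * τ) * (n * ((C₁ + C₂) * τ ^ 3)) := by
    clear hn
    induction n with
    | zero => intro _ x; simp [hu0]
    | succ n ih =>
      intro hn x
      push_cast at hn ⊢
      have hnτ : 0 ≤ n * τ := by positivity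
      have hn' : n * τ ≤ T := by linarith
      have hτT : τ ≤ T := by linarith
      set W : {W : Sp d → MSp m // BddC 6 B' W} := ⟨_, hB' V hB τ hτ n hn'⟩
      have hloc : ∀ x, ‖splitStep (κ / 2) τ W.1 x - taylorSol κ W.1 τ x‖ ≤ C₂ * τ ^ 3 := by
        intro x
        have := hC₂ W τ hτ.le hτT x
        rwa [mul_div_cancel₀ κ two_ne_zero] at this
      have key := norm_sub_splitStep_le (u := u) hκ.le hC₁0
        (δ := Real.exp (n * τ) * (n * ((C₁ + C₂) * τ ^ 3))) (by positivity) hnτ hτ huc hup hu2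
        hud W.2 (hVp.splitStep_iterate _ _ n)
        (fun t ht htτ x => hC₁ W t ht (htτ.trans hτT) x) hloc (ih hn') x
      rw [Function.iterate_succ_apply', show (n + 1) * τ = n * τ + τ by ring]
      refine key.trans ?_
      have e1 : 1 ≤ Real.exp (n * τ + τ) := Real.one_le_exp (by positivity)
      have e2 : Real.exp τ ≤ Real.exp (n * τ + τ) := Real.exp_le_exp.2 (by linarith)
      have e3 : Real.exp τ * Real.exp (n * τ) = Real.exp (n * τ + τ) := by
        rw [← Real.exp_add, add_comm]
      have e4 : 0 ≤ C₁ * τ ^ 3 := by positivity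
      have e5 : 0 ≤ C₂ * τ ^ 3 := by positivity
      calc Real.exp τ * (Real.exp (n * τ) * (n * ((C₁ + C₂) * τ ^ 3)) + C₁ * τ ^ 3) + C₂ * τ ^ 3
          = Real.exp (n * τ + τ) * (n * ((C₁ + C₂) * τ ^ 3)) + Real.exp τ * (C₁ * τ ^ 3)
            + 1 * (C₂ * τ ^ 3) := by rw [← e3]; ring
        _ ≤ Real.exp (n * τ + τ) * (n * ((C₁ + C₂) * τ ^ 3))
            + Real.exp (n * τ + τ) * (C₁ * τ ^ 3) + Real.exp (n * τ + τ) * (C₂ * τ ^ 3) := by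
            gcongr
        _ = _ := by ring
  intro x
  have hn0 : 0 ≤ n * τ := by positivity
  calc ‖u (n * τ) x - (splitStep (κ / 2) τ)^[n] V x‖
      ≤ Real.exp (n * τ) * (n * ((C₁ + C₂) * τ ^ 3)) := main hn x
    _ = Real.exp (n * τ) * (n * τ * (C₁ + C₂)) * τ ^ 2 := by ring
    _ ≤ Real.exp T * (T * (C₁ + C₂)) * τ ^ 2 := by gcongr

/-- The cell is compact, so its measure is finite and a uniform bound controls the $L^2$ norm. -/
lemma normL2_le_of_frobNorm_le {V : Sp d → Mat m} {K : ℝ} (h : ∀ x, frobNorm (V x) ≤ K) :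
    normL2 V ≤ ENNReal.ofReal (((volume (cell d)) ^ (1 / 2 : ℝ)).toReal * K) := by
  have hfin : (volume (cell d)) ^ (1 / 2 : ℝ) ≠ ∞ :=
    ENNReal.rpow_ne_top_of_nonneg (by norm_num) (isCompact_cell d).measure_lt_top.ne
  have h1 := eLpNorm_le_of_ae_bound (p := 2) (μ := volume.restrict (cell d))
    (f := fun x => frobNorm (V x)) (C := K) (Eventually.of_forall fun x => by
      rw [Real.norm_of_nonneg (show 0 ≤ frobNorm (V x) from Real.sqrt_nonneg _)]; exact h x)
  rw [Measure.restrict_apply_univ] at h1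
  rw [ENNReal.ofReal_mul ENNReal.toReal_nonneg, ENNReal.ofReal_toReal hfin]
  refine h1.trans (le_of_eq ?_)
  norm_num

end GlobalError

end MAC

end

/-! ### The convergence theorem. -/

theorem theorem3p7 (d m : ℕ) :
    ∃ k : ℕ, ∀ ε : ℝ, 0 < ε →
      ∀ U₀ : EuclideanSpace ℝ (Fin d) → Matrix (Fin m) (Fin m) ℝ,
        MAC.TorusPeriodic U₀ →
        (∀ i j, ContDiff ℝ k (fun x => U₀ x i j)) →
        (∀ x, MAC.frobNorm (U₀ x) ≤ Real.sqrt m) →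
        ∀ T : ℝ, 0 < T →
          ∃ C : ℝ, 0 < C ∧
            ∀ U : ℝ → EuclideanSpace ℝ (Fin d) → Matrix (Fin m) (Fin m) ℝ,
              MAC.IsSolution ε U₀ U →
              ∀ τ : ℝ, 0 < τ → ∀ n : ℕ, 1 ≤ n → n * τ ≤ T →
                MAC.normL2 (fun x => MAC.strang ε τ U₀ n x - U (n * τ) x)
                  ≤ ENNReal.ofReal (C * τ ^ 2) := by
  refine ⟨6, fun ε hε U₀ hper hU₀ _ T hT => ?_⟩
  set V : MAC.Sp d → MAC.MSp m := fun x => MAC.toMat.symm (U₀ x)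
  have hVp : MAC.PerFun V := MAC.PerFun.comp (g := U₀) (fun l x => hper l x) _
  have hV : ContDiff ℝ 6 V := MAC.contDiff_toMat_symm hU₀
  obtain ⟨hbdd, C, hC0, hC⟩ :=
    MAC.exists_norm_sub_splitStep_iterate_le (κ := ε ^ 2) (by positivity) hV hVp hT
  set M : ℝ := ((volume (MAC.cell d)) ^ (1 / 2 : ℝ)).toReal
  have hM : 0 ≤ M := ENNReal.toReal_nonneg
  -- `M * C` is only known to be nonnegative; the summand 1 makes the constant positive.
  refine ⟨M * C + 1, by positivity, fun U hU τ hτ n _ hnT => ?_⟩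
  have herr := hC (fun t x => MAC.toMat.symm (U t x)) hU.continuousOn_toMat_symm
    (fun t ht => MAC.PerFun.comp (g := U t) (fun l x => hU.periodic t ht l x) _)
    (fun t ht => MAC.contDiff_toMat_symm (hU.contDiff t ht))
    (fun t ht x => hU.hasDerivAt_toMat_symm ht x)
    (fun x => by simp only [V, hU.init]) τ hτ n hnT
  have hstrang : MAC.strang ε τ U₀ n
      = fun x => MAC.toMat ((MAC.splitStep (ε ^ 2 / 2) τ)^[n] V x) := by
    rw [← MAC.strang_toMat hε hτ fun j hj => hbdd τ hτ j ?_]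
    · congr 1
    · refine le_trans ?_ hnT
      gcongr
  refine (MAC.normL2_le_of_frobNorm_le (K := C * τ ^ 2) fun x => ?_).trans ?_
  · have e : MAC.strang ε τ U₀ n x - U (n * τ) x
        = MAC.toMat ((MAC.splitStep (ε ^ 2 / 2) τ)^[n] V x - MAC.toMat.symm (U (n * τ) x)) := by
      rw [hstrang, map_sub, LinearEquiv.apply_symm_apply]
    rw [e, ← MAC.norm_eq_frobNorm, norm_sub_rev]
    exact herr x
  · refine ENNReal.ofReal_le_ofReal ?_
    have : 0 ≤ τ ^ 2 := by positivity
    change M * (C * τ ^ 2) ≤ _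
    linarith
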